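/- Let $\Sigma=\mathbb{CP}^2\#\overline{\mathbb{CP}}{}^2$, realised as the complex surface obtained by blowing up $\mathbb{CP}^2$ at the point $[1:0:0]$, that is $$\Sigma=\{([Z_0:Z_1:Z_2],[w_0:w_1])\in\mathbb{CP}^2\times\mathbb{CP}^1 : Z_1w_1=Z_2w_0\},$$ with the action of $U(2)$ given by $A\cdot(Z_0,Z',w)=(Z_0,AZ',Aw)$, where $Z'=(Z_1,Z_2)$. For a Riemannian metric, $s$ denotes the scalar curvature and $\Delta=\operatorname{div}\nabla$ the Laplacian. A Kähler metric on $\Sigma$ is extremal if the gradient of its scalar curvature is a holomorphic vector field. The Page metric with Einstein constant $\Lambda$ is the $U(2)$-invariant Einstein metric $g$ on $\Sigma$, $\mathrm{Rc}(g)=\Lambda g$, which is conformal to an extremal Kähler metric $k$ with positive scalar curvature $s$ by $g=s^{-2}k$. (i) Let $k$ be an extremal Kähler metric on $\Sigma$ with scalar curvature $s>0$ such that $s^{-2}k$ is the Page metric with Einstein constant $3$. Then $$\Delta_k s^2<\tfrac{15}{4}$$ at every point of $\Sigma$. (ii) More precisely, let $k$ be an extremal Kähler metric on $\Sigma$ with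 scalar curvature $s>0$, in any normalization, such that $g=s^{-2}k$ is the Page metric with some Einstein constant, and let $\kappa$ be the (constant) scalar curvature of $g$. Then $\kappa>0$, the function $\Delta_k s^2$ is bounded above on $\Sigma$, and its supremum $K=\sup_\Sigma \Delta_k s^2$ satisfies $$\tfrac{12}{\kappa}K<2.65 .$$ -/

import Mathlib

open scoped ContDiff LinearAlgebra.Projectivization Matrix

noncomputable section

namespace PageBlowup

/-! ## Local Riemannian geometry on `ℂ²` (real dimension four) -/

/-- The model space of all coordinate charts. -/
abbrev CTwo : Type := ℂ × ℂ

/-- A field of real bilinear forms on a coordinate chart `ℂ²`. -/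
abbrev FormField : Type := CTwo → CTwo →L[ℝ] CTwo →L[ℝ] ℝ

/-- The real coordinate frame `∂/∂x₁, ∂/∂y₁, ∂/∂x₂, ∂/∂y₂` of `ℂ²`. -/
def frame : Fin 4 → CTwo := ![(1, 0), (Complex.I, 0), (0, 1), (0, Complex.I)]

/-- Partial derivative in the direction of the `a`-th real coordinate. -/
def pd (a : Fin 4) (f : CTwo → ℝ) (p : CTwo) : ℝ := fderiv ℝ f p (frame a)

/-- The matrix `(g_{ab})` of the field in real coordinates. -/
def gram (g : FormField) (p : CTwo) : Matrix (Fin 4) (Fin 4) ℝ :=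
  Matrix.of fun a b => g p (frame a) (frame b)

/-- The inverse matrix `(g^{ab})`. -/
def gramInv (g : FormField) (p : CTwo) : Matrix (Fin 4) (Fin 4) ℝ := (gram g p)⁻¹

/-- Christoffel symbols `Γ^c_{ab}` of the Levi-Civita connection. -/
def christoffel (g : FormField) (c a b : Fin 4) (p : CTwo) : ℝ :=
  (1 / 2 : ℝ) * ∑ d, gramInv g p c d *
    (pd a (fun q => gram g q b d) p + pd b (fun q => gram g q a d) p
      - pd d (fun q => gram g q a b) p)

/-- The Ricci tensor `R_{ab}` (positive on round spheres). -/
def ricci (g : FormField) (a b : Fin 4) (p : CTwo) : ℝ :=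
  ∑ c, (pd c (christoffel g c a b) p - pd b (christoffel g c c a) p)
    + ∑ c, ∑ d, (christoffel g c c d p * christoffel g d a b p
        - christoffel g c b d p * christoffel g d c a p)

/-- The scalar curvature `g^{ab} R_{ab}`. -/
def scal (g : FormField) (p : CTwo) : ℝ := ∑ a, ∑ b, gramInv g p a b * ricci g a b p

/-- The Laplace–Beltrami operator `Δ f = g^{ab} ∇_a ∇_b f` (trace of the Hessian). -/
def laplacian (g : FormField) (f : CTwo → ℝ) (p : CTwo) : ℝ :=
  ∑ a, ∑ b, gramInv g p a b * (pd a (pd b f) p - ∑ c, christoffel g c a b p * pd c f p)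

/-- The gradient vector field `g^{ab} (∂_b f) ∂_a`. -/
def gradient (g : FormField) (f : CTwo → ℝ) (p : CTwo) : CTwo :=
  ∑ a, (∑ b, gramInv g p a b * pd b f p) • frame a

/-- Multiplication by `i`, the complex structure, acting on tangent vectors. -/
def Jc (v : CTwo) : CTwo := Complex.I • v

/-! ## The complex surface `ℂP² # -ℂP²`, i.e. the blow-up of `ℂP²` at `[1 : 0 : 0]` -/

/-- Pairs `(Z, w)` of vectors of homogeneous coordinates on `ℂP² × ℂP¹`. -/
abbrev HomCoord : Type := (Fin 3 → ℂ) × (Fin 2 → ℂ)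

/-- The blow-up of `ℂP²` at `[1 : 0 : 0]`:
`{([Z₀ : Z₁ : Z₂], [w₀ : w₁]) | Z₁ w₁ = Z₂ w₀} ⊆ ℂP² × ℂP¹`. -/
def blowup : Set (ℙ ℂ (Fin 3 → ℂ) × ℙ ℂ (Fin 2 → ℂ)) :=
  {x | x.1.rep 1 * x.2.rep 1 = x.1.rep 2 * x.2.rep 0}

/-- Labels of the four standard holomorphic charts of the blow-up.  The first entry `0` means a
chart meeting the exceptional curve, `1` one meeting the line at infinity; the second entry `l` is
the index of the coordinate `w_l` of `ℂP¹` that is normalised to `1`. -/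
abbrev ChartIx : Type := Fin 2 × Fin 2

/-- The vector `w` with `w_l = 1` and the other entry equal to `v`. -/
def fibreVec (l : Fin 2) (v : ℂ) : Fin 2 → ℂ := if l = 0 then ![1, v] else ![v, 1]

/-- Homogeneous coordinates of the point with coordinates `(u, v)` in a given chart:
`Z = (1, u w)` near the exceptional curve and `Z = (u, w)` near infinity. -/
def lift (c : ChartIx) (p : CTwo) : HomCoord :=
  (if c.1 = 0 then Matrix.vecCons 1 (p.1 • fibreVec c.2 p.2)
    else Matrix.vecCons p.1 (fibreVec c.2 p.2), fibreVec c.2 p.2)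

/-- The domain of a chart, in homogeneous coordinates. -/
def InChart (c : ChartIx) (x : HomCoord) : Prop :=
  x.2 c.2 ≠ 0 ∧ (if c.1 = 0 then x.1 0 ≠ 0 else x.1 c.2.succ ≠ 0)

/-- The coordinates `(u, v)` of a chart in terms of homogeneous coordinates. -/
def coord (c : ChartIx) (x : HomCoord) : CTwo :=
  (if c.1 = 0 then x.1 c.2.succ / x.1 0 else x.1 0 / x.1 c.2.succ, x.2 (1 - c.2) / x.2 c.2)

/-- The action of a `2 × 2` matrix on homogeneous coordinates,
`(Z₀, Z₁, Z₂; w) ↦ (Z₀, A (Z₁, Z₂); A w)`; for invertible `A` it preserves the blow-up, and acts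
there by a biholomorphism. -/
def act (A : Matrix (Fin 2) (Fin 2) ℂ) (x : HomCoord) : HomCoord :=
  (Matrix.vecCons (x.1 0) (A *ᵥ Matrix.vecTail x.1), A *ᵥ x.2)

/-- The map `x ↦ A x` of the blow-up, read in chart `c` at the source and `d` at the target. -/
def chartAct (A : Matrix (Fin 2) (Fin 2) ℂ) (c d : ChartIx) (p : CTwo) : CTwo :=
  coord d (act A (lift c p))

/-- The coordinate change from chart `c` to chart `d`. -/
def transition (c d : ChartIx) (p : CTwo) : CTwo := coord d (lift c p)

theorem fibreVec_self (l : Fin 2) (v : ℂ) : fibreVec l v l = 1 := by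
  fin_cases l <;> simp [fibreVec]

theorem fibreVec_other (l : Fin 2) (v : ℂ) : fibreVec l v (1 - l) = v := by
  fin_cases l <;> simp [fibreVec]

theorem lift_snd_ne (c : ChartIx) (p : CTwo) : (lift c p).2 ≠ 0 := fun h => by
  have := congrFun h c.2
  simp [lift, fibreVec_self] at this

theorem lift_fst_ne (c : ChartIx) (p : CTwo) : (lift c p).1 ≠ 0 := fun h => by
  by_cases hc : c.1 = 0
  · have := congrFun h 0
    simp [lift, hc] at this
  · have := congrFun h c.2.succ
    simp [lift, hc, fibreVec_self] at this

/-- The point of `ℂP² × ℂP¹` with coordinates `p` in chart `c`. -/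
def param (c : ChartIx) (p : CTwo) : ℙ ℂ (Fin 3 → ℂ) × ℙ ℂ (Fin 2 → ℂ) :=
  (Projectivization.mk ℂ (lift c p).1 (lift_fst_ne c p),
    Projectivization.mk ℂ (lift c p).2 (lift_snd_ne c p))

theorem mk_mem_blowup_iff {Z : Fin 3 → ℂ} {w : Fin 2 → ℂ} (hZ : Z ≠ 0) (hw : w ≠ 0) :
    (Projectivization.mk ℂ Z hZ, Projectivization.mk ℂ w hw) ∈ blowup ↔
      Z 1 * w 1 = Z 2 * w 0 := by
  obtain ⟨s, hs⟩ := Projectivization.exists_smul_eq_mk_rep ℂ Z hZ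
  obtain ⟨t, ht⟩ := Projectivization.exists_smul_eq_mk_rep ℂ w hw
  simp only [blowup, Set.mem_ofPred_eq, ← hs, ← ht, Pi.smul_apply, Units.smul_def, smul_eq_mul]
  have h : (s : ℂ) * t ≠ 0 := mul_ne_zero s.ne_zero t.ne_zero
  constructor
  · intro e
    apply mul_left_cancel₀ h
    linear_combination e
  · intro e
    linear_combination (s * t : ℂ) * e

/-- A point of the blow-up lying in the domain of a chart is recovered from its coordinates. -/
theorem param_coord {Z : Fin 3 → ℂ} {w : Fin 2 → ℂ} (hZ : Z ≠ 0) (hw : w ≠ 0)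
    (hZw : Z 1 * w 1 = Z 2 * w 0) (c : ChartIx) (hc : InChart c (Z, w)) :
    param c (coord c (Z, w)) = (Projectivization.mk ℂ Z hZ, Projectivization.mk ℂ w hw) := by
  obtain ⟨m, l⟩ := c
  obtain ⟨h1, h2⟩ := hc
  simp only [param, Prod.mk.injEq, Projectivization.mk_eq_mk_iff']
  constructor
  · fin_cases m <;> fin_cases l <;> simp at h1 h2
    · refine ⟨(Z 0)⁻¹, ?_⟩
      ext i; fin_cases i <;> simp [lift, coord, fibreVec] <;> field_simp
      linear_combination -hZw
    · refine ⟨(Z 0)⁻¹, ?_⟩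
      ext i; fin_cases i <;> simp [lift, coord, fibreVec] <;> field_simp
      linear_combination hZw
    · refine ⟨(Z 1)⁻¹, ?_⟩
      ext i; fin_cases i <;> simp [lift, coord, fibreVec, h2] <;> field_simp
      linear_combination -hZw
    · refine ⟨(Z 2)⁻¹, ?_⟩
      ext i; fin_cases i <;> simp [lift, coord, fibreVec, h2] <;> field_simp
      linear_combination hZw
  · refine ⟨(w l)⁻¹, ?_⟩
    fin_cases l <;> simp at h1 <;>
    · ext i; fin_cases i <;> simp [lift, coord, fibreVec, h1] <;> field_simp

theorem param_mem (c : ChartIx) (p : CTwo) : param c p ∈ blowup := by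
  rw [param, mk_mem_blowup_iff]
  obtain ⟨m, l⟩ := c
  fin_cases m <;> fin_cases l <;> simp [lift, fibreVec]

/-- The four charts cover exactly the blow-up. -/
theorem mem_blowup_iff (x : ℙ ℂ (Fin 3 → ℂ) × ℙ ℂ (Fin 2 → ℂ)) :
    x ∈ blowup ↔ ∃ c p, param c p = x := by
  refine ⟨fun hx => ?_, fun ⟨c, p, h⟩ => h ▸ param_mem c p⟩
  obtain ⟨y, z⟩ := x
  induction y using Projectivization.ind with | h Z hZ => ?_
  induction z using Projectivization.ind with | h w hw => ?_
  rw [mk_mem_blowup_iff] at hx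
  obtain ⟨l, hl⟩ : ∃ l, w l ≠ 0 := Function.ne_iff.1 hw
  by_cases h0 : Z 0 = 0
  · refine ⟨(1, l), _, param_coord hZ hw hx (1, l) ⟨hl, ?_⟩⟩
    simp only [one_ne_zero, if_false]
    intro h
    apply hZ
    fin_cases l <;> simp at h hl
    · have : Z 2 = 0 := by simpa [h, hl] using hx.symm
      ext i; fin_cases i <;> simp [h0, h, this]
    · have : Z 1 = 0 := by simpa [h, hl] using hx
      ext i; fin_cases i <;> simp [h0, h, this]
  · exact ⟨(0, l), _, param_coord hZ hw hx (0, l) ⟨hl, by simpa using h0⟩⟩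

theorem coord_smul (d : ChartIx) (x : HomCoord) {s t : ℂ} (hs : s ≠ 0) (ht : t ≠ 0) :
    coord d (s • x.1, t • x.2) = coord d x := by
  simp [coord, mul_div_mul_left _ _ hs, mul_div_mul_left _ _ ht]

theorem inChart_lift (c : ChartIx) (p : CTwo) : InChart c (lift c p) := by
  obtain ⟨m, l⟩ := c
  fin_cases m <;> fin_cases l <;> simp [InChart, lift, fibreVec]

theorem coord_lift (c : ChartIx) (p : CTwo) : coord c (lift c p) = p := by
  obtain ⟨m, l⟩ := c
  fin_cases m <;> fin_cases l <;> simp [coord, lift, fibreVec]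

/-- Two coordinate vectors describe the same point exactly when the transition map takes one to
the other. -/
theorem param_eq_param_iff (c d : ChartIx) (p q : CTwo) :
    param c p = param d q ↔ InChart d (lift c p) ∧ q = transition c d p := by
  constructor
  · intro h
    simp only [param, Prod.mk.injEq, Projectivization.mk_eq_mk_iff] at h
    obtain ⟨⟨s, hs⟩, t, ht⟩ := h
    have hx : lift c p = ((s : ℂ) • (lift d q).1, (t : ℂ) • (lift d q).2) :=
      Prod.ext hs.symm ht.symm
    constructor
    · have hd := inChart_lift d q
      rw [hx]
      simpa [InChart] using hd
    · rw [transition, hx, coord_smul d (lift d q) s.ne_zero t.ne_zero, coord_lift]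
  · rintro ⟨h, rfl⟩
    have hm := param_mem c p
    rw [param, mk_mem_blowup_iff] at hm
    exact (param_coord (lift_fst_ne c p) (lift_snd_ne c p) hm d h).symm

/-! ## Riemannian metrics on the blow-up -/

/-- A smooth Riemannian metric on the blow-up: a smooth field of positive definite symmetric
bilinear forms in each of the four charts, compatible with the coordinate changes. -/
structure Metric where
  form : ChartIx → FormField
  smooth : ∀ c, ContDiff ℝ ∞ (form c)
  symm : ∀ c p v w, form c p v w = form c p w v
  pos : ∀ c p v, v ≠ 0 → 0 < form c p v v
  compat : ∀ c d p, InChart d (lift c p) → ∀ v w,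
    form c p v w = form d (transition c d p)
      (fderiv ℝ (transition c d) p v) (fderiv ℝ (transition c d) p w)

namespace Metric

/-- The scalar curvature; a point of the blow-up is given by a chart and coordinates in it. -/
def scalarCurvature (g : Metric) (x : ChartIx × CTwo) : ℝ := scal (g.form x.1) x.2

/-- `Δ_k (s²)`, where `s` is the scalar curvature of `k`. -/
def laplacianScalSq (k : Metric) (x : ChartIx × CTwo) : ℝ :=
  laplacian (k.form x.1) (fun q => (scal (k.form x.1) q) ^ 2) x.2

/-- The Einstein equation `Rc = Λ g`. -/
def IsEinstein (g : Metric) (Λ : ℝ) : Prop :=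
  ∀ c p a b, ricci (g.form c) a b p = Λ * gram (g.form c) p a b

/-- Kähler with respect to the complex structure of the blow-up: the metric is Hermitian, and the
form `ω(v, w) = g(Jv, w)` is closed. -/
def IsKahler (k : Metric) : Prop :=
  (∀ c p v w, k.form c p (Jc v) (Jc w) = k.form c p v w) ∧
  ∀ c p u v w,
    fderiv ℝ (fun q => k.form c q (Jc v) w) p u + fderiv ℝ (fun q => k.form c q (Jc w) u) p v
      + fderiv ℝ (fun q => k.form c q (Jc u) v) p w = 0

/-- Calabi's condition for an extremal Kähler metric: the gradient of the scalar curvature is a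
holomorphic vector field. -/
def IsExtremal (k : Metric) : Prop :=
  k.IsKahler ∧ ∀ c, Differentiable ℂ (gradient (k.form c) (scal (k.form c)))

/-- Invariance under the action of `U(2)` on the blow-up. -/
def IsU2Invariant (g : Metric) : Prop :=
  ∀ A ∈ Matrix.unitaryGroup (Fin 2) ℂ, ∀ c d p, InChart d (act A (lift c p)) → ∀ v w,
    g.form c p v w = g.form d (chartAct A c d p)
      (fderiv ℝ (chartAct A c d) p v) (fderiv ℝ (chartAct A c d) p w)

/-- `g` is the Page metric, with Einstein constant `Λ`: the `U(2)`-invariant Einstein metric on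
`ℂP² # -ℂP²`. -/
def IsPage (g : Metric) (Λ : ℝ) : Prop := g.IsU2Invariant ∧ g.IsEinstein Λ

/-- `g = s⁻² k`, where `s > 0` is the scalar curvature of `k`. -/
def IsScalRescaling (g k : Metric) : Prop :=
  (∀ x, 0 < k.scalarCurvature x) ∧
  ∀ c p, g.form c p = ((scal (k.form c) p) ^ 2)⁻¹ • k.form c p

end Metric

end PageBlowup

end

/-!
The proof reduces both claims to an inequality between polynomials in one real variable.

A `U(2)`-invariant Hermitian metric `g` is, off the exceptional curve and the line at infinity, of
Calabi type: it is determined by two functions of `ρ = |Z₁|² + |Z₂|²` (in units `Z₀ = 1`), see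
`Metric.isCalabi`. Invariance of `k` is not assumed, but if `k = s² g` is Kähler with Kähler form
`s² ω`, then `d(s²) ∧ ω = -s² dω` forces `ds` to be proportional to `dρ` (`grad_conformal_factor`).
Hence `s` is a function of `ρ`, and `k` is of Calabi type as well (`scal_eq_radialScal`,
`isCalabi_radial_kahler`).

Write `k` in terms of its momentum coordinate `x` and its momentum profile `θ = ρ dx/dρ`; along the
axis `v = 0` the Gram matrix has the diagonal entries `θ / ρ` and `x`. With primes for derivatives
with respect to `x`,
* extremality makes `s` affine in `x`, `s = α x + β` (`exists_hasDerivAt_radialScal`);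
* `scal k = s` reads `x s = 8 - 4 (x θ)''` (`hasDerivAt_momentumSlope`);
* `scal g = κ` reads `x (κ - s³) = 24 α (s (x θ)' - 2 α x θ)` (`conformal_scal_eq`);
* `Δ s² = 8 α (α θ + s (x θ)' / x)` (`laplacian_calabi`, `laplacian_calabiInf`).

Smoothness at the two boundary curves gives `θ = 0` there, with `θ' = 1` at the exceptional curve
and `θ' = -1` at the line at infinity. These closing conditions determine everything up to scale:
the ratio `t` of the values of `s` on the two curves satisfies `t⁴ - 4 t - 3 = 0`
(`page_ratio_eq`), and `α`, `β`, `κ` are rational functions of `t` (`page_constants`). Eliminating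
`θ` and `θ'`, the bound `Δ s² ≤ 2.6495 κ / 12` becomes the positivity of a quartic in `s`
(`page_quartic_pos`), whose minimum is only slightly above zero: the supremum of `12 Δ s² / κ` is
about `2.6485`. On the boundary curves themselves the bound follows by continuity.
-/

noncomputable section

namespace PageBlowup

open Filter Topology ComplexConjugate

/-! ### Gradients in the real coordinate frame -/

/-- `f` is differentiable at `p` with partial derivatives `d 0, …, d 3` in the real frame. -/
def HasGrad (f : CTwo → ℝ) (d : Fin 4 → ℝ) (p : CTwo) : Prop :=
  DifferentiableAt ℝ f p ∧ ∀ a, pd a f p = d a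

theorem eq_sum_frame (v : CTwo) :
    v = v.1.re • frame 0 + v.1.im • frame 1 + v.2.re • frame 2 + v.2.im • frame 3 := by
  refine Prod.ext ?_ ?_ <;> apply Complex.ext <;> simp [frame]

theorem fderiv_eq_sum_pd (f : CTwo → ℝ) (p v : CTwo) :
    fderiv ℝ f p v =
      v.1.re * pd 0 f p + v.1.im * pd 1 f p + v.2.re * pd 2 f p + v.2.im * pd 3 f p := by
  conv_lhs => rw [eq_sum_frame v]
  simp only [map_add, map_smul, smul_eq_mul, pd]

namespace HasGrad

variable {f g : CTwo → ℝ} {d e : Fin 4 → ℝ} {p : CTwo}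

theorem congr_grad (h : HasGrad f d p) (hd : ∀ a, d a = e a) : HasGrad f e p :=
  ⟨h.1, fun a => (h.2 a).trans (hd a)⟩

theorem congr_fun (h : HasGrad f d p) (hf : ∀ q, g q = f q) : HasGrad g d p := by
  obtain rfl : g = f := funext hf
  exact h

theorem congr_eventually (h : HasGrad f d p) (hf : g =ᶠ[𝓝 p] f) : HasGrad g d p :=
  ⟨h.1.congr_of_eventuallyEq hf, fun a => by rw [pd, hf.fderiv_eq]; exact h.2 a⟩

theorem const (r : ℝ) : HasGrad (fun _ => r) (fun _ => 0) p :=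
  ⟨differentiableAt_const r, fun a => by simp [pd]⟩

theorem add (hf : HasGrad f d p) (hg : HasGrad g e p) :
    HasGrad (fun q => f q + g q) (fun a => d a + e a) p :=
  ⟨hf.1.add hg.1, fun a => by
    rw [pd, fderiv_fun_add hf.1 hg.1]
    exact congrArg₂ (· + ·) (hf.2 a) (hg.2 a)⟩

theorem sub (hf : HasGrad f d p) (hg : HasGrad g e p) :
    HasGrad (fun q => f q - g q) (fun a => d a - e a) p :=
  ⟨hf.1.sub hg.1, fun a => by
    rw [pd, fderiv_fun_sub hf.1 hg.1]
    exact congrArg₂ (· - ·) (hf.2 a) (hg.2 a)⟩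

theorem neg (hf : HasGrad f d p) : HasGrad (fun q => -f q) (fun a => -d a) p :=
  ⟨hf.1.neg, fun a => by
    rw [pd, fderiv_fun_neg]
    exact congrArg (-·) (hf.2 a)⟩

theorem mul (hf : HasGrad f d p) (hg : HasGrad g e p) :
    HasGrad (fun q => f q * g q) (fun a => d a * g p + f p * e a) p :=
  ⟨hf.1.mul hg.1, fun a => by
    rw [pd, fderiv_fun_mul hf.1 hg.1]
    change f p * pd a g p + g p * pd a f p = d a * g p + f p * e a
    rw [hf.2 a, hg.2 a]
    ring⟩

/-- The chain rule for a function of one real variable. -/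
theorem comp {F : ℝ → ℝ} {F' : ℝ} (hF : HasDerivAt F F' (f p)) (hf : HasGrad f d p) :
    HasGrad (fun q => F (f q)) (fun a => F' * d a) p := by
  have h := hF.hasFDerivAt.comp p hf.1.hasFDerivAt
  refine ⟨h.differentiableAt, fun a => ?_⟩
  have h2 : fderiv ℝ (fun q => F (f q)) p = _ := h.fderiv
  rw [pd, h2]
  change pd a f p * F' = F' * d a
  rw [hf.2 a, mul_comm]

theorem inv (hf : HasGrad f d p) (h0 : f p ≠ 0) :
    HasGrad (fun q => (f q)⁻¹) (fun a => -(f p ^ 2)⁻¹ * d a) p :=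
  comp (F := fun x => x⁻¹) (hasDerivAt_inv h0) hf

theorem div (hf : HasGrad f d p) (hg : HasGrad g e p) (h0 : g p ≠ 0) :
    HasGrad (fun q => f q / g q) (fun a => (d a * g p - f p * e a) / g p ^ 2) p := by
  refine ((hf.mul (hg.inv h0)).congr_grad fun a => ?_).congr_fun fun q => div_eq_mul_inv _ _
  field_simp
  ring

theorem unique (h : HasGrad f d p) (h' : HasGrad f e p) (a : Fin 4) : d a = e a :=
  (h.2 a).symm.trans (h'.2 a)

end HasGrad

theorem hasGrad_x1 (p : CTwo) : HasGrad (fun q => q.1.re) ![1, 0, 0, 0] p := by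
  have h : HasFDerivAt (fun q : CTwo => q.1.re)
      (Complex.reCLM.comp (ContinuousLinearMap.fst ℝ ℂ ℂ)) p :=
    (Complex.reCLM.comp (ContinuousLinearMap.fst ℝ ℂ ℂ)).hasFDerivAt
  refine ⟨h.differentiableAt, fun a => ?_⟩
  rw [pd, h.fderiv]; fin_cases a <;> simp [frame]

theorem hasGrad_y1 (p : CTwo) : HasGrad (fun q => q.1.im) ![0, 1, 0, 0] p := by
  have h : HasFDerivAt (fun q : CTwo => q.1.im)
      (Complex.imCLM.comp (ContinuousLinearMap.fst ℝ ℂ ℂ)) p :=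
    (Complex.imCLM.comp (ContinuousLinearMap.fst ℝ ℂ ℂ)).hasFDerivAt
  refine ⟨h.differentiableAt, fun a => ?_⟩
  rw [pd, h.fderiv]; fin_cases a <;> simp [frame]

theorem hasGrad_x2 (p : CTwo) : HasGrad (fun q => q.2.re) ![0, 0, 1, 0] p := by
  have h : HasFDerivAt (fun q : CTwo => q.2.re)
      (Complex.reCLM.comp (ContinuousLinearMap.snd ℝ ℂ ℂ)) p :=
    (Complex.reCLM.comp (ContinuousLinearMap.snd ℝ ℂ ℂ)).hasFDerivAt
  refine ⟨h.differentiableAt, fun a => ?_⟩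
  rw [pd, h.fderiv]; fin_cases a <;> simp [frame]

theorem hasGrad_y2 (p : CTwo) : HasGrad (fun q => q.2.im) ![0, 0, 0, 1] p := by
  have h : HasFDerivAt (fun q : CTwo => q.2.im)
      (Complex.imCLM.comp (ContinuousLinearMap.snd ℝ ℂ ℂ)) p :=
    (Complex.imCLM.comp (ContinuousLinearMap.snd ℝ ℂ ℂ)).hasFDerivAt
  refine ⟨h.differentiableAt, fun a => ?_⟩
  rw [pd, h.fderiv]; fin_cases a <;> simp [frame]

theorem contDiff_pd {f : CTwo → ℝ} (hf : ContDiff ℝ ∞ f) (a : Fin 4) : ContDiff ℝ ∞ (pd a f) :=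
  (hf.fderiv_right (m := ∞) (by simp)).clm_apply contDiff_const

theorem hasGrad_of_contDiff {f : CTwo → ℝ} (hf : ContDiff ℝ ∞ f) (p : CTwo) :
    HasGrad f (fun a => pd a f p) p :=
  ⟨(hf.differentiable (by simp)) p, fun _ => rfl⟩

/-! ### Jets of the metric and its curvature -/

theorem contDiff_gram {g : FormField} (hg : ContDiff ℝ ∞ g) (a b : Fin 4) :
    ContDiff ℝ ∞ (fun p => gram g p a b) :=
  (hg.clm_apply contDiff_const).clm_apply contDiff_const

theorem contDiff_det {n : ℕ} {A : CTwo → Matrix (Fin n) (Fin n) ℝ}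
    (hA : ∀ a b, ContDiff ℝ ∞ (fun p => A p a b)) : ContDiff ℝ ∞ (fun p => (A p).det) := by
  simp only [Matrix.det_apply]
  exact ContDiff.sum fun σ _ => (contDiff_prod fun i _ => hA _ _).const_smul _

theorem contDiff_gramInv {g : FormField} (hg : ContDiff ℝ ∞ g)
    (hdet : ∀ p, (gram g p).det ≠ 0) (a b : Fin 4) :
    ContDiff ℝ ∞ (fun p => gramInv g p a b) := by
  have h : (fun p => gramInv g p a b) =
      fun p => ((gram g p).det)⁻¹ * ((gram g p).updateRow b (Pi.single a 1)).det := by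
    funext p
    rw [gramInv, Matrix.inv_def, Ring.inverse_eq_inv', Matrix.smul_apply, smul_eq_mul,
      Matrix.adjugate_apply]
  rw [h]
  refine ((contDiff_det (contDiff_gram hg)).inv hdet).mul (contDiff_det fun i j => ?_)
  by_cases hi : i = b
  · subst hi; simpa using contDiff_const
  · simpa [Matrix.updateRow_ne hi] using contDiff_gram hg i j

theorem contDiff_christoffel {g : FormField} (hg : ContDiff ℝ ∞ g)
    (hdet : ∀ p, (gram g p).det ≠ 0) (c a b : Fin 4) : ContDiff ℝ ∞ (christoffel g c a b) := by
  refine contDiff_const.mul (ContDiff.sum fun d _ => (contDiff_gramInv hg hdet c d).mul ?_)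
  exact ((contDiff_pd (contDiff_gram hg b d) a).add (contDiff_pd (contDiff_gram hg a d) b)).sub
    (contDiff_pd (contDiff_gram hg a b) d)

theorem continuous_laplacian {g : FormField} (hg : ContDiff ℝ ∞ g)
    (hdet : ∀ p, (gram g p).det ≠ 0) {f : CTwo → ℝ} (hf : ContDiff ℝ ∞ f) :
    Continuous (laplacian g f) := by
  refine continuous_finsetSum _ fun a _ => continuous_finsetSum _ fun b _ => ?_
  refine (contDiff_gramInv hg hdet a b).continuous.mul ?_
  refine (contDiff_pd (contDiff_pd hf b) a).continuous.sub ?_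
  exact continuous_finsetSum _ fun c _ =>
    (contDiff_christoffel hg hdet c a b).continuous.mul (contDiff_pd hf c).continuous

theorem gramInv_mul_gram {g : FormField} {p : CTwo} (hdet : (gram g p).det ≠ 0) :
    gramInv g p * gram g p = 1 :=
  Matrix.nonsing_inv_mul _ hdet.isUnit

theorem gram_mul_gramInv {g : FormField} {p : CTwo} (hdet : (gram g p).det ≠ 0) :
    gram g p * gramInv g p = 1 :=
  Matrix.mul_nonsing_inv _ hdet.isUnit

/-- The derivative of the inverse matrix, at a point where the inverse is diagonal. -/
theorem pd_gramInv_of_diagonal {g : FormField} (hg : ContDiff ℝ ∞ g)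
    (hdet : ∀ p, (gram g p).det ≠ 0) {p : CTwo} {w : Fin 4 → ℝ}
    (hw : gramInv g p = Matrix.diagonal w) (e a b : Fin 4) :
    pd e (fun q => gramInv g q a b) p = -(w a * pd e (fun q => gram g q a b) p * w b) := by
  have hGi := fun a b => hasGrad_of_contDiff (contDiff_gramInv hg hdet a b) p
  have hG := fun a b => hasGrad_of_contDiff (contDiff_gram hg a b) p
  -- differentiate `∑ c, g⁻¹ a c * g c d = δ a d`
  have key : ∀ d, ∑ c, (pd e (fun q => gramInv g q a c) p * gram g p c d
      + gramInv g p a c * pd e (fun q => gram g q c d) p) = 0 := by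
    intro d
    have h1 : HasGrad (fun q => gramInv g q a 0 * gram g q 0 d + gramInv g q a 1 * gram g q 1 d
        + gramInv g q a 2 * gram g q 2 d + gramInv g q a 3 * gram g q 3 d) _ p :=
      ((((hGi a 0).mul (hG 0 d)).add ((hGi a 1).mul (hG 1 d))).add
        ((hGi a 2).mul (hG 2 d))).add ((hGi a 3).mul (hG 3 d))
    have h2 := (HasGrad.const (p := p) ((1 : Matrix (Fin 4) (Fin 4) ℝ) a d)).congr_fun
      (g := fun q => gramInv g q a 0 * gram g q 0 d + gramInv g q a 1 * gram g q 1 d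
        + gramInv g q a 2 * gram g q 2 d + gramInv g q a 3 * gram g q 3 d) (fun q => by
          rw [← gramInv_mul_gram (hdet q), Matrix.mul_apply, Fin.sum_univ_four])
    have := h1.unique h2 e
    rw [Fin.sum_univ_four]
    exact this
  have hs : ∑ d, (∑ c, (pd e (fun q => gramInv g q a c) p * gram g p c d
      + gramInv g p a c * pd e (fun q => gram g q c d) p)) * gramInv g p d b = 0 := by
    simp only [key, zero_mul, Finset.sum_const_zero]
  have h1 : ∑ d, (∑ c, pd e (fun q => gramInv g q a c) p * gram g p c d) * gramInv g p d b
      = pd e (fun q => gramInv g q a b) p := by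
    have := congrFun (congrFun (Matrix.mul_assoc
      (Matrix.of fun a c => pd e (fun q => gramInv g q a c) p) (gram g p) (gramInv g p)) a) b
    rw [gram_mul_gramInv (hdet p), mul_one] at this
    simpa [Matrix.mul_apply] using this
  simp only [Finset.sum_add_distrib, add_mul] at hs
  rw [h1, hw] at hs
  simp [Matrix.diagonal_apply] at hs
  linarith

/-- Twice the Christoffel symbols of the first kind. -/
def lowChristoffel (g : FormField) (d a b : Fin 4) (p : CTwo) : ℝ :=
  pd a (fun q => gram g q b d) p + pd b (fun q => gram g q a d) p
    - pd d (fun q => gram g q a b) p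

theorem christoffel_of_diagonal {g : FormField} {p : CTwo} {w : Fin 4 → ℝ}
    (hw : gramInv g p = Matrix.diagonal w) (c a b : Fin 4) :
    christoffel g c a b p = 1 / 2 * (w c * lowChristoffel g c a b p) := by
  simp [christoffel, hw, Matrix.diagonal_apply, lowChristoffel]

theorem pd_christoffel_of_diagonal {g : FormField} (hg : ContDiff ℝ ∞ g)
    (hdet : ∀ p, (gram g p).det ≠ 0) {p : CTwo} {w : Fin 4 → ℝ}
    (hw : gramInv g p = Matrix.diagonal w) (e c a b : Fin 4) :
    pd e (christoffel g c a b) p =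
      1 / 2 * (w c * (pd e (pd a (fun q => gram g q b c)) p
          + pd e (pd b (fun q => gram g q a c)) p - pd e (pd c (fun q => gram g q a b)) p)
        - ∑ d, w c * pd e (fun q => gram g q c d) p * w d * lowChristoffel g d a b p) := by
  have hGi := fun a b => hasGrad_of_contDiff (contDiff_gramInv hg hdet a b) p
  have hT := fun x y z => hasGrad_of_contDiff (contDiff_pd (contDiff_gram hg y z) x) p
  have hL : ∀ d, HasGrad (lowChristoffel g d a b) _ p := fun d =>
    ((hT a b d).add (hT b a d)).sub (hT d a b)
  have h := (HasGrad.const (1 / 2)).mul (((((hGi c 0).mul (hL 0)).add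
    ((hGi c 1).mul (hL 1))).add ((hGi c 2).mul (hL 2))).add ((hGi c 3).mul (hL 3)))
  have h' := h.congr_fun (g := christoffel g c a b) (fun q => by
    simp only [christoffel, Fin.sum_univ_four]; rfl)
  rw [h'.2 e]
  simp only [pd_gramInv_of_diagonal hg hdet hw, hw, Fin.sum_univ_four, Matrix.diagonal_apply]
  fin_cases c <;> simp <;> ring

/-! ### Metrics of Calabi type near the exceptional curve -/

/-- `|u|² (1 + |v|²)`, the squared norm of `(Z₁, Z₂) / Z₀`, in the coordinates `(u, v)` of a chart
meeting the exceptional curve. -/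
def sqNorm (q : CTwo) : ℝ := (q.1.re ^ 2 + q.1.im ^ 2) * (1 + q.2.re ^ 2 + q.2.im ^ 2)

/-- The Gram matrix of `A(ρ) |N ξ₁ + u v̄ ξ₂ / N|² + B(ρ) |ξ₂|² / N⁴`, where `N² = 1 + |v|²` and
`ρ = |u|² N²`: the general Hermitian form invariant under `U(2)` in the chart `(u, v)`. -/
def calabiMatrix (A B : ℝ → ℝ) (q : CTwo) : Matrix (Fin 4) (Fin 4) ℝ :=
  let H := A (sqNorm q) * (1 + q.2.re ^ 2 + q.2.im ^ 2)
  let R := A (sqNorm q) * (q.1.re * q.2.re + q.1.im * q.2.im)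
  let I := A (sqNorm q) * (q.1.re * q.2.im - q.1.im * q.2.re)
  let E := A (sqNorm q) * (q.1.re ^ 2 + q.1.im ^ 2) * (q.2.re ^ 2 + q.2.im ^ 2)
      / (1 + q.2.re ^ 2 + q.2.im ^ 2) + B (sqNorm q) / (1 + q.2.re ^ 2 + q.2.im ^ 2) ^ 2
  !![H, 0, R, I; 0, H, -I, R; R, -I, E, 0; I, R, 0, E]

/-- Away from `u = 0`, the form field has the Gram matrix `calabiMatrix A B`. -/
def IsCalabi (g : FormField) (A B : ℝ → ℝ) : Prop :=
  ∀ q : CTwo, q.1 ≠ 0 → gram g q = calabiMatrix A B q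

theorem normSq_fibre_pos (q : CTwo) : 0 < 1 + q.2.re ^ 2 + q.2.im ^ 2 := by positivity

theorem normSq_pos_of_ne {z : ℂ} (hz : z ≠ 0) : 0 < z.re ^ 2 + z.im ^ 2 := by
  have := Complex.normSq_pos.2 hz
  rw [Complex.normSq_apply] at this
  nlinarith

theorem sqNorm_pos {q : CTwo} (hq : q.1 ≠ 0) : 0 < sqNorm q :=
  mul_pos (normSq_pos_of_ne hq) (normSq_fibre_pos q)

theorem eventually_fst_ne {p : CTwo} (hp : p.1 ≠ 0) : ∀ᶠ q in 𝓝 p, q.1 ≠ 0 :=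
  (continuous_fst.continuousAt (x := p)).eventually_ne hp

theorem hasGrad_normSq_fst (q : CTwo) :
    HasGrad (fun q => q.1.re ^ 2 + q.1.im ^ 2) ![2 * q.1.re, 2 * q.1.im, 0, 0] q := by
  refine ((((hasGrad_x1 q).mul (hasGrad_x1 q)).add
    ((hasGrad_y1 q).mul (hasGrad_y1 q))).congr_grad fun a => ?_).congr_fun fun q => by ring
  fin_cases a <;> simp <;> ring

theorem hasGrad_normSq_snd (q : CTwo) :
    HasGrad (fun q => q.2.re ^ 2 + q.2.im ^ 2) ![0, 0, 2 * q.2.re, 2 * q.2.im] q := by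
  refine ((((hasGrad_x2 q).mul (hasGrad_x2 q)).add
    ((hasGrad_y2 q).mul (hasGrad_y2 q))).congr_grad fun a => ?_).congr_fun fun q => by ring
  fin_cases a <;> simp <;> ring

theorem hasGrad_fibre (q : CTwo) :
    HasGrad (fun q => 1 + q.2.re ^ 2 + q.2.im ^ 2) ![0, 0, 2 * q.2.re, 2 * q.2.im] q := by
  refine (((HasGrad.const 1).add (hasGrad_normSq_snd q)).congr_grad fun a => ?_).congr_fun
    fun q => by ring
  simp

theorem hasGrad_sqNorm (q : CTwo) :
    HasGrad sqNorm
      ![2 * q.1.re * (1 + q.2.re ^ 2 + q.2.im ^ 2), 2 * q.1.im * (1 + q.2.re ^ 2 + q.2.im ^ 2),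
        2 * q.2.re * (q.1.re ^ 2 + q.1.im ^ 2), 2 * q.2.im * (q.1.re ^ 2 + q.1.im ^ 2)] q := by
  refine (((hasGrad_normSq_fst q).mul (hasGrad_fibre q)).congr_grad fun a => ?_).congr_fun
    fun q => rfl
  fin_cases a <;> simp <;> ring

section Entries

variable {A A1 B B1 : ℝ → ℝ}

theorem hasGrad_calabi_H (hA : ∀ x, 0 < x → HasDerivAt A (A1 x) x) {q : CTwo} (hq : q.1 ≠ 0) :
    HasGrad (fun q => calabiMatrix A B q 0 0)
      ![2 * (q.1.re * (A1 (sqNorm q) * (1 + q.2.re ^ 2 + q.2.im ^ 2) ^ 2)),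
        2 * (q.1.im * (A1 (sqNorm q) * (1 + q.2.re ^ 2 + q.2.im ^ 2) ^ 2)),
        2 * (q.2.re * (A1 (sqNorm q) * sqNorm q + A (sqNorm q))),
        2 * (q.2.im * (A1 (sqNorm q) * sqNorm q + A (sqNorm q)))] q := by
  refine ((((hasGrad_sqNorm q).comp (hA _ (sqNorm_pos hq))).mul
    (hasGrad_fibre q)).congr_grad fun a => ?_).congr_fun fun q => by simp [calabiMatrix]
  fin_cases a <;> simp <;> simp only [sqNorm] <;> ring

theorem hasGrad_calabi_R (hA : ∀ x, 0 < x → HasDerivAt A (A1 x) x) {q : CTwo} (hq : q.1 ≠ 0) :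
    HasGrad (fun q => calabiMatrix A B q 0 2)
      ![A1 (sqNorm q) * (2 * q.1.re * (1 + q.2.re ^ 2 + q.2.im ^ 2))
          * (q.1.re * q.2.re + q.1.im * q.2.im) + A (sqNorm q) * q.2.re,
        A1 (sqNorm q) * (2 * q.1.im * (1 + q.2.re ^ 2 + q.2.im ^ 2))
          * (q.1.re * q.2.re + q.1.im * q.2.im) + A (sqNorm q) * q.2.im,
        A1 (sqNorm q) * (2 * q.2.re * (q.1.re ^ 2 + q.1.im ^ 2))
          * (q.1.re * q.2.re + q.1.im * q.2.im) + A (sqNorm q) * q.1.re,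
        A1 (sqNorm q) * (2 * q.2.im * (q.1.re ^ 2 + q.1.im ^ 2))
          * (q.1.re * q.2.re + q.1.im * q.2.im) + A (sqNorm q) * q.1.im] q := by
  refine ((((hasGrad_sqNorm q).comp (hA _ (sqNorm_pos hq))).mul
    (((hasGrad_x1 q).mul (hasGrad_x2 q)).add
      ((hasGrad_y1 q).mul (hasGrad_y2 q)))).congr_grad fun a => ?_).congr_fun
    fun q => by simp [calabiMatrix]
  fin_cases a <;> simp

theorem hasGrad_calabi_I (hA : ∀ x, 0 < x → HasDerivAt A (A1 x) x) {q : CTwo} (hq : q.1 ≠ 0) :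
    HasGrad (fun q => calabiMatrix A B q 0 3)
      ![A1 (sqNorm q) * (2 * q.1.re * (1 + q.2.re ^ 2 + q.2.im ^ 2))
          * (q.1.re * q.2.im - q.1.im * q.2.re) + A (sqNorm q) * q.2.im,
        A1 (sqNorm q) * (2 * q.1.im * (1 + q.2.re ^ 2 + q.2.im ^ 2))
          * (q.1.re * q.2.im - q.1.im * q.2.re) - A (sqNorm q) * q.2.re,
        A1 (sqNorm q) * (2 * q.2.re * (q.1.re ^ 2 + q.1.im ^ 2))
          * (q.1.re * q.2.im - q.1.im * q.2.re) - A (sqNorm q) * q.1.im,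
        A1 (sqNorm q) * (2 * q.2.im * (q.1.re ^ 2 + q.1.im ^ 2))
          * (q.1.re * q.2.im - q.1.im * q.2.re) + A (sqNorm q) * q.1.re] q := by
  refine ((((hasGrad_sqNorm q).comp (hA _ (sqNorm_pos hq))).mul
    (((hasGrad_x1 q).mul (hasGrad_y2 q)).sub
      ((hasGrad_y1 q).mul (hasGrad_x2 q)))).congr_grad fun a => ?_).congr_fun
    fun q => by simp [calabiMatrix]
  fin_cases a <;> simp <;> ring

theorem hasGrad_calabi_E (hA : ∀ x, 0 < x → HasDerivAt A (A1 x) x)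
    (hB : ∀ x, 0 < x → HasDerivAt B (B1 x) x) {q : CTwo} (hq : q.1 ≠ 0) :
    HasGrad (fun q => calabiMatrix A B q 2 2)
      ![2 * (q.1.re * (A1 (sqNorm q) * (q.1.re ^ 2 + q.1.im ^ 2) * (q.2.re ^ 2 + q.2.im ^ 2)
          + (A (sqNorm q) * (q.2.re ^ 2 + q.2.im ^ 2) + B1 (sqNorm q))
            * (1 + q.2.re ^ 2 + q.2.im ^ 2)⁻¹)),
        2 * (q.1.im * (A1 (sqNorm q) * (q.1.re ^ 2 + q.1.im ^ 2) * (q.2.re ^ 2 + q.2.im ^ 2)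
          + (A (sqNorm q) * (q.2.re ^ 2 + q.2.im ^ 2) + B1 (sqNorm q))
            * (1 + q.2.re ^ 2 + q.2.im ^ 2)⁻¹)),
        2 * (q.2.re * ((q.1.re ^ 2 + q.1.im ^ 2) * (A1 (sqNorm q) * (q.1.re ^ 2 + q.1.im ^ 2)
              * (q.2.re ^ 2 + q.2.im ^ 2) * (1 + q.2.re ^ 2 + q.2.im ^ 2)⁻¹
            + (A (sqNorm q) + B1 (sqNorm q)) * (1 + q.2.re ^ 2 + q.2.im ^ 2)⁻¹ ^ 2)
            - 2 * (B (sqNorm q) * (1 + q.2.re ^ 2 + q.2.im ^ 2)⁻¹ ^ 3))),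
        2 * (q.2.im * ((q.1.re ^ 2 + q.1.im ^ 2) * (A1 (sqNorm q) * (q.1.re ^ 2 + q.1.im ^ 2)
              * (q.2.re ^ 2 + q.2.im ^ 2) * (1 + q.2.re ^ 2 + q.2.im ^ 2)⁻¹
            + (A (sqNorm q) + B1 (sqNorm q)) * (1 + q.2.re ^ 2 + q.2.im ^ 2)⁻¹ ^ 2)
            - 2 * (B (sqNorm q) * (1 + q.2.re ^ 2 + q.2.im ^ 2)⁻¹ ^ 3)))] q := by
  have hM := (normSq_fibre_pos q).ne'
  have hiM := (hasGrad_fibre q).inv hM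
  refine ((((((hasGrad_sqNorm q).comp (hA _ (sqNorm_pos hq))).mul (hasGrad_normSq_fst q)).mul
      (hasGrad_normSq_snd q)).mul hiM).add
    ((((hasGrad_sqNorm q).comp (hB _ (sqNorm_pos hq))).mul hiM).mul hiM)
    |>.congr_grad fun a => ?_).congr_fun
    fun q => by have := (normSq_fibre_pos q).ne'; simp [calabiMatrix]; field_simp
  fin_cases a <;> simp <;> field_simp <;> ring

end Entries

/-! ### The scalar curvature on the axis -/

theorem pd_pd_of_eventually {f h : CTwo → ℝ} {D : CTwo → Fin 4 → ℝ} {d : Fin 4 → ℝ} {p : CTwo}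
    (hf : ∀ᶠ q in 𝓝 p, HasGrad f (D q) q) {a : Fin 4} (hD : ∀ q, D q a = h q)
    (hh : HasGrad h d p) (e : Fin 4) : pd e (pd a f) p = d e :=
  (hh.congr_eventually (hf.mono fun q hq => (hq.2 a).trans (hD q))).2 e

theorem pd_neg (a : Fin 4) (f : CTwo → ℝ) : pd a (fun q => -f q) = fun q => -pd a f q := by
  funext q
  rw [pd, fderiv_fun_neg]
  rfl

theorem pd_zero (a : Fin 4) : pd a (fun _ => 0) = fun _ => 0 := by
  funext q
  simp [pd]

section Jets

variable {A A1 A2 B B1 B2 : ℝ → ℝ}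

/-- The scalar curvature of a metric of Calabi type, at the point `(r, 0)`. -/
theorem scal_calabi {g : FormField} (hg : ContDiff ℝ ∞ g) (hdet : ∀ p, (gram g p).det ≠ 0)
    (hc : IsCalabi g A B) (hA : ∀ x, 0 < x → HasDerivAt A (A1 x) x)
    (hA1 : ∀ x, 0 < x → HasDerivAt A1 (A2 x) x) (hB : ∀ x, 0 < x → HasDerivAt B (B1 x) x)
    (hB1 : ∀ x, 0 < x → HasDerivAt B1 (B2 x) x) {r : ℝ} (hr : 0 < r) {x : ℝ} (hx : x = r ^ 2)
    (hA0 : A x ≠ 0) (hB0 : B x ≠ 0) :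
    scal g ((r : ℂ), 0) =
      -(4 / (x * A x)) * (x / A x * (2 * A1 x + x * A2 x)
          + 1 / 2 * (1 / A x - x * A1 x / A x ^ 2) * (A x + x * A1 x))
        + 2 * (x / A x) * (A x + x * A1 x) ^ 2 / (x * A x) ^ 2
        - 8 / B x * (x / A x * B2 x + 1 / 2 * (1 / A x - x * A1 x / A x ^ 2) * B1 x)
        + 2 * (x / A x) * B1 x ^ 2 / B x ^ 2
        - 4 * (x / A x) * (A x + x * A1 x) * B1 x / (x * A x * B x)
        + 8 / B x - 2 * (x * A x) / B x ^ 2 := by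
  set p : CTwo := ((r : ℂ), 0) with hp
  have hp1 : p.1 ≠ 0 := by simpa [hp] using hr.ne'
  have hρ : sqNorm p = x := by simp [sqNorm, hp, hx]
  have hρ0 := sqNorm_pos hp1
  have hev := eventually_fst_ne hp1
  have e0 : p.1.re = r := rfl
  have e1 : p.1.im = 0 := rfl
  have e2 : p.2.re = 0 := rfl
  have e3 : p.2.im = 0 := rfl
  have hgr : ∀ a b, (fun q => gram g q a b) =ᶠ[𝓝 p] fun q => calabiMatrix A B q a b :=
    fun a b => hev.mono fun q hq => by simp only [hc q hq]
  have hT : ∀ c a b, pd c (fun q => gram g q a b) p = pd c (fun q => calabiMatrix A B q a b) p :=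
    fun c a b => by rw [pd, (hgr a b).fderiv_eq, pd]
  have hU : ∀ e c a b, pd e (pd c (fun q => gram g q a b)) p =
      pd e (pd c (fun q => calabiMatrix A B q a b)) p := by
    intro e c a b
    have : pd c (fun q => gram g q a b) =ᶠ[𝓝 p] pd c (fun q => calabiMatrix A B q a b) := by
      filter_upwards [(hgr a b).eventuallyEq_nhds] with q hq
      rw [pd, hq.fderiv_eq, pd]
    rw [pd, this.fderiv_eq, pd]
  have hw : gramInv g p = Matrix.diagonal ![(A x)⁻¹, (A x)⁻¹, (B x)⁻¹, (B x)⁻¹] := by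
    refine Matrix.inv_eq_left_inv ?_
    rw [hc p hp1]
    ext i j
    fin_cases i <;> fin_cases j <;>
      simp [calabiMatrix, Matrix.mul_apply, Fin.sum_univ_four, hρ, hA0, hB0, e1, e2, e3]
  -- the first jet of the Gram matrix
  have hH := fun (q : CTwo) (hq : q.1 ≠ 0) => hasGrad_calabi_H (B := B) hA hq
  have hR := fun (q : CTwo) (hq : q.1 ≠ 0) => hasGrad_calabi_R (B := B) hA hq
  have hI := fun (q : CTwo) (hq : q.1 ≠ 0) => hasGrad_calabi_I (B := B) hA hq
  have hE := fun (q : CTwo) (hq : q.1 ≠ 0) => hasGrad_calabi_E hA hB hq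
  have H1 := (hH p hp1).2
  have R1 := (hR p hp1).2
  have I1 := (hI p hp1).2
  have E1 := (hE p hp1).2
  simp only [Fin.forall_fin_succ, e0, e1, e2, e3, hρ] at H1 R1 I1 E1
  simp at H1 R1 I1 E1
  -- the second jet, as far as the curvature involves it
  have gA := (hasGrad_sqNorm p).comp (hA _ hρ0)
  have gB := (hasGrad_sqNorm p).comp (hB _ hρ0)
  have gA1 := (hasGrad_sqNorm p).comp (hA1 _ hρ0)
  have gB1 := (hasGrad_sqNorm p).comp (hB1 _ hρ0)
  have gρ := hasGrad_sqNorm p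
  have gM := hasGrad_fibre p
  have giM := gM.inv (normSq_fibre_pos p).ne'
  have gQ := hasGrad_normSq_fst p
  have gV := hasGrad_normSq_snd p
  have x1 := hasGrad_x1 p
  have y1 := hasGrad_y1 p
  have x2 := hasGrad_x2 p
  have y2 := hasGrad_y2 p
  have g2 := HasGrad.const (p := p) 2
  have hH' := hev.mono hH
  have hR' := hev.mono hR
  have hI' := hev.mono hI
  have hE' := hev.mono hE
  have pH0 := pd_pd_of_eventually (a := 0) hH' (fun q => rfl)
    ((g2.mul (x1.mul (gA1.mul (gM.mul gM)))).congr_fun fun q => by simp [sq]) 0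
  have pH1 := pd_pd_of_eventually (a := 1) hH' (fun q => rfl)
    ((g2.mul (y1.mul (gA1.mul (gM.mul gM)))).congr_fun fun q => by simp [sq]) 1
  have pH2 := pd_pd_of_eventually (a := 2) hH' (fun q => rfl)
    ((g2.mul (x2.mul ((gA1.mul gρ).add gA))).congr_fun fun q => by simp [sq]) 2
  have pH3 := pd_pd_of_eventually (a := 3) hH' (fun q => rfl)
    ((g2.mul (y2.mul ((gA1.mul gρ).add gA))).congr_fun fun q => by simp [sq]) 3
  have pE0 := pd_pd_of_eventually (a := 0) hE' (fun q => rfl)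
    ((g2.mul (x1.mul (((gA1.mul gQ).mul gV).add
      (((gA.mul gV).add gB1).mul giM)))).congr_fun fun q => by simp [pow_succ]) 0
  have pE1 := pd_pd_of_eventually (a := 1) hE' (fun q => rfl)
    ((g2.mul (y1.mul (((gA1.mul gQ).mul gV).add
      (((gA.mul gV).add gB1).mul giM)))).congr_fun fun q => by simp [pow_succ]) 1
  have pE2 := pd_pd_of_eventually (a := 2) hE' (fun q => rfl)
    ((g2.mul (x2.mul ((gQ.mul ((((gA1.mul gQ).mul gV).mul giM).add
      ((gA.add gB1).mul (giM.mul giM)))).sub (g2.mul (gB.mul ((giM.mul giM).mul giM)))))).congr_fun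
      fun q => by simp [pow_succ]) 2
  have pE3 := pd_pd_of_eventually (a := 3) hE' (fun q => rfl)
    ((g2.mul (y2.mul ((gQ.mul ((((gA1.mul gQ).mul gV).mul giM).add
      ((gA.add gB1).mul (giM.mul giM)))).sub (g2.mul (gB.mul ((giM.mul giM).mul giM)))))).congr_fun
      fun q => by simp [pow_succ]) 3
  have pR20 := pd_pd_of_eventually (a := 0) hR' (fun q => rfl)
    (((gA1.mul ((g2.mul x1).mul gM)).mul ((x1.mul x2).add (y1.mul y2))).add (gA.mul x2)) 2
  have pR02 := pd_pd_of_eventually (a := 2) hR' (fun q => rfl)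
    (((gA1.mul ((g2.mul x2).mul gQ)).mul ((x1.mul x2).add (y1.mul y2))).add (gA.mul x1)) 0
  have pR31 := pd_pd_of_eventually (a := 1) hR' (fun q => rfl)
    (((gA1.mul ((g2.mul y1).mul gM)).mul ((x1.mul x2).add (y1.mul y2))).add (gA.mul y2)) 3
  have pR13 := pd_pd_of_eventually (a := 3) hR' (fun q => rfl)
    (((gA1.mul ((g2.mul y2).mul gQ)).mul ((x1.mul x2).add (y1.mul y2))).add (gA.mul y1)) 1
  have pI30 := pd_pd_of_eventually (a := 0) hI' (fun q => rfl)
    (((gA1.mul ((g2.mul x1).mul gM)).mul ((x1.mul y2).sub (y1.mul x2))).add (gA.mul y2)) 3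
  have pI03 := pd_pd_of_eventually (a := 3) hI' (fun q => rfl)
    (((gA1.mul ((g2.mul y2).mul gQ)).mul ((x1.mul y2).sub (y1.mul x2))).add (gA.mul x1)) 0
  have pI21 := pd_pd_of_eventually (a := 1) hI' (fun q => rfl)
    (((gA1.mul ((g2.mul y1).mul gM)).mul ((x1.mul y2).sub (y1.mul x2))).sub (gA.mul x2)) 2
  have pI12 := pd_pd_of_eventually (a := 2) hI' (fun q => rfl)
    (((gA1.mul ((g2.mul x2).mul gQ)).mul ((x1.mul y2).sub (y1.mul x2))).sub (gA.mul y1)) 1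
  simp [e0, e1, e2, e3, hρ] at pH0 pH1 pH2 pH3 pE0 pE1 pE2 pE3
  simp [e0, e1, e2, e3, hρ] at pR20 pR02 pR31 pR13 pI30 pI03 pI21 pI12
  obtain ⟨H10, H11, H12, H13⟩ := H1
  obtain ⟨R10, R11, R12, R13⟩ := R1
  obtain ⟨I10, I11, I12, I13⟩ := I1
  obtain ⟨E10, E11, E12, E13⟩ := E1
  have c01 : (fun q => calabiMatrix A B q 0 1) = fun _ => 0 := rfl
  have c10 : (fun q => calabiMatrix A B q 1 0) = fun _ => 0 := rfl
  have c23 : (fun q => calabiMatrix A B q 2 3) = fun _ => 0 := rfl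
  have c32 : (fun q => calabiMatrix A B q 3 2) = fun _ => 0 := rfl
  have c11 : (fun q => calabiMatrix A B q 1 1) = fun q => calabiMatrix A B q 0 0 := rfl
  have c33 : (fun q => calabiMatrix A B q 3 3) = fun q => calabiMatrix A B q 2 2 := rfl
  have c20 : (fun q => calabiMatrix A B q 2 0) = fun q => calabiMatrix A B q 0 2 := rfl
  have c13 : (fun q => calabiMatrix A B q 1 3) = fun q => calabiMatrix A B q 0 2 := rfl
  have c31 : (fun q => calabiMatrix A B q 3 1) = fun q => calabiMatrix A B q 0 2 := rfl
  have c30 : (fun q => calabiMatrix A B q 3 0) = fun q => calabiMatrix A B q 0 3 := rfl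
  have c12 : (fun q => calabiMatrix A B q 1 2) = fun q => -calabiMatrix A B q 0 3 := rfl
  have c21 : (fun q => calabiMatrix A B q 2 1) = fun q => -calabiMatrix A B q 0 3 := rfl
  have hscal : scal g p = (A x)⁻¹ * ricci g 0 0 p + (A x)⁻¹ * ricci g 1 1 p
      + (B x)⁻¹ * ricci g 2 2 p + (B x)⁻¹ * ricci g 3 3 p := by
    simp [scal, hw, Fin.sum_univ_four, Matrix.diagonal_apply]
  rw [hscal]
  simp only [ricci, pd_christoffel_of_diagonal hg hdet hw, christoffel_of_diagonal hw,
    lowChristoffel, hT, hU, Fin.sum_univ_four]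
  simp [c01, c10, c23, c32, c11, c33, c20, c13, c31, c30, c12, c21, pd_neg, pd_zero,
    pH0, pH1, pH2, pH3, pE0, pE1, pE2, pE3, pR20, pR02, pR31, pR13, pI30, pI03, pI21, pI12,
    H10, H11, H12, H13, R10, R11, R12, R13, I10, I11, I12, I13, E10, E11, E12, E13]
  have hr0 := hr.ne'
  rw [hx] at hA0 hB0 ⊢
  field_simp
  ring

end Jets

/-! ### Hermitian and Kähler forms in the real frame -/

/-- The Gram matrix of the Hermitian form with coefficients `h₁₁ = H`, `h₁₂ = R + i I`,
`h₂₂ = E`. -/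
def hermMatrix (H R I E : ℝ) : Matrix (Fin 4) (Fin 4) ℝ :=
  !![H, 0, R, I; 0, H, -I, R; R, -I, E, 0; I, R, 0, E]

theorem Jc_frame_zero : Jc (frame 0) = frame 1 := by simp [Jc, frame]

theorem Jc_frame_one : Jc (frame 1) = -frame 0 := by simp [Jc, frame]

theorem Jc_frame_two : Jc (frame 2) = frame 3 := by simp [Jc, frame]

theorem Jc_frame_three : Jc (frame 3) = -frame 2 := by simp [Jc, frame]

/-- The form field is symmetric and invariant under the complex structure. -/
def IsHermitianForm (g : FormField) : Prop :=
  (∀ p v w, g p v w = g p w v) ∧ ∀ p v w, g p (Jc v) (Jc w) = g p v w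

theorem gram_eq_hermMatrix {g : FormField} (h : IsHermitianForm g) (p : CTwo) :
    gram g p = hermMatrix (gram g p 0 0) (gram g p 0 2) (gram g p 0 3) (gram g p 2 2) := by
  obtain ⟨hs, hJ⟩ := h
  have j01 := hJ p (frame 0) (frame 1)
  have j00 := hJ p (frame 0) (frame 0)
  have j02 := hJ p (frame 0) (frame 2)
  have j03 := hJ p (frame 0) (frame 3)
  have j22 := hJ p (frame 2) (frame 2)
  have j23 := hJ p (frame 2) (frame 3)
  simp only [Jc_frame_zero, Jc_frame_one, Jc_frame_two, Jc_frame_three, map_neg] at *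
  have s01 := hs p (frame 0) (frame 1)
  have s23 := hs p (frame 2) (frame 3)
  ext i j
  fin_cases i <;> fin_cases j <;> simp [gram, hermMatrix]
  · linarith
  · linarith
  · linarith
  · linarith
  · linarith
  · exact hs _ _ _
  · rw [hs]; linarith
  · linarith
  · exact hs _ _ _
  · rw [hs]; linarith
  · linarith
  · linarith

theorem det_hermMatrix (H R I E : ℝ) :
    (hermMatrix H R I E).det = (H * E - R ^ 2 - I ^ 2) ^ 2 := by
  simp [hermMatrix, Matrix.det_succ_row_zero, Fin.sum_univ_succ, Fin.succAbove]
  ring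

theorem inv_hermMatrix {H R I E : ℝ} (h : H * E - R ^ 2 - I ^ 2 ≠ 0) :
    (hermMatrix H R I E)⁻¹ =
      (H * E - R ^ 2 - I ^ 2)⁻¹ • hermMatrix E (-R) (-I) H := by
  refine Matrix.inv_eq_left_inv ?_
  ext i j
  fin_cases i <;> fin_cases j <;>
    simp [hermMatrix, Matrix.mul_apply, Fin.sum_univ_four] <;> field_simp <;> ring

/-- The exterior derivative of `ω(v, w) = g(J v, w)` vanishes, in terms of the entries of the Gram
matrix. -/
def IsClosedAt (g : FormField) (p : CTwo) : Prop :=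
  (-pd 0 (fun q => gram g q 0 2) p + pd 1 (fun q => gram g q 0 3) p
    + pd 2 (fun q => gram g q 0 0) p = 0) ∧
  (-pd 0 (fun q => gram g q 0 3) p - pd 1 (fun q => gram g q 0 2) p
    + pd 3 (fun q => gram g q 0 0) p = 0) ∧
  (pd 0 (fun q => gram g q 2 2) p - pd 2 (fun q => gram g q 0 2) p
    - pd 3 (fun q => gram g q 0 3) p = 0) ∧
  (pd 1 (fun q => gram g q 2 2) p + pd 2 (fun q => gram g q 0 3) p
    - pd 3 (fun q => gram g q 0 2) p = 0)

theorem isHermitianForm_of_isKahler {k : Metric} (hk : k.IsKahler) (c : ChartIx) :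
    IsHermitianForm (k.form c) :=
  ⟨k.symm c, hk.1 c⟩

theorem isClosedAt_of_isKahler {k : Metric} (hk : k.IsKahler) (c : ChartIx) (p : CTwo) :
    IsClosedAt (k.form c) p := by
  have hH : ∀ q, gram (k.form c) q = _ := gram_eq_hermMatrix (isHermitianForm_of_isKahler hk c)
  have key := fun a b d => hk.2 c p (frame a) (frame b) (frame d)
  have e : ∀ a b, (fun q => k.form c q (frame a) (frame b)) = fun q => gram (k.form c) q a b :=
    fun a b => rfl
  have e' : ∀ a b, (fun q => k.form c q (-frame a) (frame b)) =
      fun q => -gram (k.form c) q a b := fun a b => by funext q; simp [gram]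
  have p11 : (fun q => gram (k.form c) q 1 1) = fun q => gram (k.form c) q 0 0 := by
    funext q; rw [hH]; rfl
  have p33 : (fun q => gram (k.form c) q 3 3) = fun q => gram (k.form c) q 2 2 := by
    funext q; rw [hH]; rfl
  have p30 : (fun q => gram (k.form c) q 3 0) = fun q => gram (k.form c) q 0 3 := by
    funext q; rw [hH]; rfl
  have p20 : (fun q => gram (k.form c) q 2 0) = fun q => gram (k.form c) q 0 2 := by
    funext q; rw [hH]; rfl
  have p12 : (fun q => gram (k.form c) q 1 2) = fun q => -gram (k.form c) q 0 3 := by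
    funext q; rw [hH]; rfl
  have p21 : (fun q => gram (k.form c) q 2 1) = fun q => -gram (k.form c) q 0 3 := by
    funext q; rw [hH]; rfl
  have k1 := key 0 1 2
  have k2 := key 0 1 3
  have k3 := key 0 2 3
  have k4 := key 1 2 3
  have hn : ∀ (a : Fin 4) (f : CTwo → ℝ), fderiv ℝ (fun q => -f q) p (frame a) = -pd a f p :=
    fun a f => congrFun (pd_neg a f) p
  simp only [Jc_frame_zero, Jc_frame_one, Jc_frame_two, Jc_frame_three, e, e', p11, p33, p30,
    p20, p12, p21, hn] at k1 k2 k3 k4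
  have ht : ∀ (a : Fin 4) (f : CTwo → ℝ), fderiv ℝ f p (frame a) = pd a f p :=
    fun a f => rfl
  have hn' : ∀ (a : Fin 4) (f : CTwo → ℝ), pd a (fun q => -f q) p = -pd a f p := hn
  simp only [ht, hn'] at k1 k2 k3 k4
  refine ⟨?_, ?_, ?_, ?_⟩ <;> linarith

/-- On a Kähler surface `g^{ab} Γ^c_{ab} = 0` in holomorphic coordinates, so that the Laplacian has
no first-order part. -/
theorem laplacian_of_kahler {g : FormField} (hh : IsHermitianForm g) {p : CTwo}
    (hdet : (gram g p).det ≠ 0) (hcl : IsClosedAt g p) (f : CTwo → ℝ) {H R I E : ℝ}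
    (hG : gram g p = hermMatrix H R I E) :
    laplacian g f p = (H * E - R ^ 2 - I ^ 2)⁻¹ *
      (E * (pd 0 (pd 0 f) p + pd 1 (pd 1 f) p) + H * (pd 2 (pd 2 f) p + pd 3 (pd 3 f) p)
        - R * (pd 0 (pd 2 f) p + pd 2 (pd 0 f) p + pd 1 (pd 3 f) p + pd 3 (pd 1 f) p)
        - I * (pd 0 (pd 3 f) p + pd 3 (pd 0 f) p - pd 1 (pd 2 f) p - pd 2 (pd 1 f) p)) := by
  have hΔ : H * E - R ^ 2 - I ^ 2 ≠ 0 := by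
    intro h0
    rw [hG, det_hermMatrix, h0] at hdet
    simp at hdet
  have hw : gramInv g p = (H * E - R ^ 2 - I ^ 2)⁻¹ • hermMatrix E (-R) (-I) H := by
    rw [gramInv, hG, inv_hermMatrix hΔ]
  have hH := gram_eq_hermMatrix hh
  set h00 := fun q => gram g q 0 0
  set h02 := fun q => gram g q 0 2
  set h03 := fun q => gram g q 0 3
  set h22 := fun q => gram g q 2 2
  have hH' : ∀ q, gram g q = hermMatrix (h00 q) (h02 q) (h03 q) (h22 q) := hH
  obtain ⟨c1, c2, c3, c4⟩ := hcl
  have hn : ∀ a (f : CTwo → ℝ), pd a (fun q => -f q) p = -pd a f p :=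
    fun a f => congrFun (pd_neg a f) p
  have hz : ∀ a, pd a (fun _ => 0) p = 0 := fun a => congrFun (pd_zero a) p
  -- the trace of the lowered Christoffel symbols vanishes
  have htr : ∀ d, ∑ a, ∑ b, gramInv g p a b * lowChristoffel g d a b p = 0 := by
    intro d
    simp only [lowChristoffel, hw, hH', Fin.sum_univ_four]
    change (-pd 0 h02 p + pd 1 h03 p + pd 2 h00 p = 0) at c1
    change (-pd 0 h03 p - pd 1 h02 p + pd 3 h00 p = 0) at c2
    change (pd 0 h22 p - pd 2 h02 p - pd 3 h03 p = 0) at c3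
    change (pd 1 h22 p + pd 2 h03 p - pd 3 h02 p = 0) at c4
    set D := (H * E - R ^ 2 - I ^ 2)⁻¹
    fin_cases d <;> simp [hermMatrix, hn, hz]
    · linear_combination (-2 * D * H) * c3 - 2 * D * R * c1 - 2 * D * I * c2
    · linear_combination (-2 * D * H) * c4 - 2 * D * R * c2 + 2 * D * I * c1
    · linear_combination (-2 * D * E) * c1 - 2 * D * R * c3 + 2 * D * I * c4
    · linear_combination (-2 * D * E) * c2 - 2 * D * R * c4 - 2 * D * I * c3
  have htr2 : ∀ c, ∑ a, ∑ b, gramInv g p a b * christoffel g c a b p = 0 := by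
    intro c
    calc ∑ a, ∑ b, gramInv g p a b * christoffel g c a b p
        = 1 / 2 * ∑ d, gramInv g p c d *
            ∑ a, ∑ b, gramInv g p a b * lowChristoffel g d a b p := by
          simp only [christoffel, lowChristoffel, Fin.sum_univ_four]; ring
      _ = 0 := by simp only [htr]; simp
  have : laplacian g f p = ∑ a, ∑ b, gramInv g p a b * pd a (pd b f) p
      - ∑ c, (∑ a, ∑ b, gramInv g p a b * christoffel g c a b p) * pd c f p := by
    simp only [laplacian, Fin.sum_univ_four]; ring
  rw [this]
  simp only [htr2, zero_mul, Finset.sum_const_zero, sub_zero]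
  simp [hw, hermMatrix, Fin.sum_univ_four]
  ring

/-! ### The Laplacian of invariant functions -/

theorem calabiMatrix_eq (A B : ℝ → ℝ) (q : CTwo) :
    calabiMatrix A B q = hermMatrix (calabiMatrix A B q 0 0) (calabiMatrix A B q 0 2)
      (calabiMatrix A B q 0 3) (calabiMatrix A B q 2 2) := rfl

theorem hermMatrix_calabi_disc (A B : ℝ → ℝ) (q : CTwo) :
    calabiMatrix A B q 0 0 * calabiMatrix A B q 2 2 - calabiMatrix A B q 0 2 ^ 2
      - calabiMatrix A B q 0 3 ^ 2 =
        A (sqNorm q) * B (sqNorm q) / (1 + q.2.re ^ 2 + q.2.im ^ 2) := by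
  have hM := (normSq_fibre_pos q).ne'
  simp [calabiMatrix]
  field_simp
  ring

/-- The Hessian of `F ∘ h` in the real frame. -/
theorem pd_pd_comp {F F1 F2 : ℝ → ℝ} {h f : CTwo → ℝ} {p : CTwo}
    {D : CTwo → Fin 4 → ℝ} {W : Fin 4 → Fin 4 → ℝ} (hD : ∀ᶠ q in 𝓝 p, HasGrad h (D q) q)
    (hW : ∀ a, HasGrad (fun q => D q a) (W a) p)
    (hF : ∀ᶠ q in 𝓝 p, HasDerivAt F (F1 (h q)) (h q)) (hF1 : HasDerivAt F1 (F2 (h p)) (h p))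
    (hf : ∀ᶠ q in 𝓝 p, f q = F (h q)) (e a : Fin 4) :
    pd e (pd a f) p = F2 (h p) * D p e * D p a + F1 (h p) * W a e := by
  have h1 : ∀ᶠ q in 𝓝 p, HasGrad f (fun a => F1 (h q) * D q a) q := by
    filter_upwards [hD, hF, hf.eventually_nhds] with q hq hFq hfq
    exact (hq.comp hFq).congr_eventually hfq
  have h2 := (hD.self_of_nhds.comp hF1).mul (hW a)
  exact pd_pd_of_eventually h1 (fun q => rfl) h2 e

/-- The Laplacian of `F(ρ)` for a Kähler metric of Calabi type. -/
theorem laplacian_calabi {g : FormField} (hh : IsHermitianForm g)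
    (hdet : ∀ p, (gram g p).det ≠ 0) {A B : ℝ → ℝ} (hc : IsCalabi g A B)
    {p : CTwo} (hp : p.1 ≠ 0) (hcl : IsClosedAt g p) {f : CTwo → ℝ} {F F1 F2 : ℝ → ℝ}
    (hF : ∀ x, 0 < x → HasDerivAt F (F1 x) x) (hF1 : ∀ x, 0 < x → HasDerivAt F1 (F2 x) x)
    (hf : ∀ q : CTwo, q.1 ≠ 0 → f q = F (sqNorm q))
    (hA0 : A (sqNorm p) ≠ 0) (hB0 : B (sqNorm p) ≠ 0) :
    laplacian g f p = 4 * (sqNorm p * F2 (sqNorm p) / A (sqNorm p)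
      + F1 (sqNorm p) / A (sqNorm p) + sqNorm p * F1 (sqNorm p) / B (sqNorm p)) := by
  have hev := eventually_fst_ne hp
  have hM := (normSq_fibre_pos p).ne'
  have x1 := hasGrad_x1 p
  have y1 := hasGrad_y1 p
  have x2 := hasGrad_x2 p
  have y2 := hasGrad_y2 p
  have gM := hasGrad_fibre p
  have gQ := hasGrad_normSq_fst p
  have g2 := HasGrad.const (p := p) 2
  have hess := fun e a => pd_pd_comp (p := p) (h := sqNorm)
    (W := ![_, _, _, _]) (Eventually.of_forall hasGrad_sqNorm)
    (Fin.forall_fin_succ.2 ⟨(g2.mul x1).mul gM, Fin.forall_fin_succ.2 ⟨(g2.mul y1).mul gM,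
      Fin.forall_fin_succ.2 ⟨(g2.mul x2).mul gQ, Fin.forall_fin_succ.2 ⟨(g2.mul y2).mul gQ,
        fun i => i.elim0⟩⟩⟩⟩)
    (hev.mono fun q hq => hF _ (sqNorm_pos hq)) (hF1 _ (sqNorm_pos hp))
    (hev.mono fun q hq => hf q hq) e a
  rw [laplacian_of_kahler hh (hdet p) hcl f ((hc p hp).trans (calabiMatrix_eq A B p)),
    hermMatrix_calabi_disc]
  simp only [hess]
  simp [calabiMatrix]
  generalize A (sqNorm p) = a at *
  generalize B (sqNorm p) = b at *
  generalize F1 (sqNorm p) = f1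
  generalize F2 (sqNorm p) = f2
  simp only [sqNorm]
  field_simp
  ring

/-- `|Z₁|² + |Z₂|²` over `|Z₀|²`, in the coordinates of a chart meeting the line at infinity. -/
def sqNormInf (q : CTwo) : ℝ := (1 + q.2.re ^ 2 + q.2.im ^ 2) / (q.1.re ^ 2 + q.1.im ^ 2)

/-- The matrix `calabiMatrix A B` after the coordinate change `(u, v) ↦ (1 / u, v)`. -/
def calabiMatrixInf (A B : ℝ → ℝ) (q : CTwo) : Matrix (Fin 4) (Fin 4) ℝ :=
  hermMatrix (A (sqNormInf q) * (1 + q.2.re ^ 2 + q.2.im ^ 2) / (q.1.re ^ 2 + q.1.im ^ 2) ^ 2)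
    (-(A (sqNormInf q) * (q.1.re * q.2.re + q.1.im * q.2.im)) / (q.1.re ^ 2 + q.1.im ^ 2) ^ 2)
    (-(A (sqNormInf q) * (q.1.re * q.2.im - q.1.im * q.2.re)) / (q.1.re ^ 2 + q.1.im ^ 2) ^ 2)
    (A (sqNormInf q) * (q.2.re ^ 2 + q.2.im ^ 2)
        / ((q.1.re ^ 2 + q.1.im ^ 2) * (1 + q.2.re ^ 2 + q.2.im ^ 2))
      + B (sqNormInf q) / (1 + q.2.re ^ 2 + q.2.im ^ 2) ^ 2)

theorem sqNormInf_pos {q : CTwo} (hq : q.1 ≠ 0) : 0 < sqNormInf q :=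
  div_pos (normSq_fibre_pos q) (normSq_pos_of_ne hq)

theorem hasGrad_sqNormInf {q : CTwo} (hq : q.1 ≠ 0) :
    HasGrad sqNormInf
      ![-(2 * q.1.re * ((1 + q.2.re ^ 2 + q.2.im ^ 2) / (q.1.re ^ 2 + q.1.im ^ 2) ^ 2)),
        -(2 * q.1.im * ((1 + q.2.re ^ 2 + q.2.im ^ 2) / (q.1.re ^ 2 + q.1.im ^ 2) ^ 2)),
        2 * q.2.re * (q.1.re ^ 2 + q.1.im ^ 2)⁻¹, 2 * q.2.im * (q.1.re ^ 2 + q.1.im ^ 2)⁻¹] q := by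
  have hQ := (normSq_pos_of_ne hq).ne'
  refine (((hasGrad_fibre q).div (hasGrad_normSq_fst q) hQ).congr_grad fun a => ?_).congr_fun
    fun q => rfl
  fin_cases a <;> simp <;> field_simp

/-- The Laplacian of `F(ρ)` in a chart meeting the line at infinity. The formula is the one of
`laplacian_calabi`, as it must be; it is computed again rather than transported. -/
theorem laplacian_calabiInf {g : FormField} (hh : IsHermitianForm g)
    (hdet : ∀ p, (gram g p).det ≠ 0) {A B : ℝ → ℝ}
    {p : CTwo} (hp : p.1 ≠ 0) (hc : gram g p = calabiMatrixInf A B p) (hcl : IsClosedAt g p)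
    {f : CTwo → ℝ} {F F1 F2 : ℝ → ℝ}
    (hF : ∀ x, 0 < x → HasDerivAt F (F1 x) x) (hF1 : ∀ x, 0 < x → HasDerivAt F1 (F2 x) x)
    (hf : ∀ q : CTwo, q.1 ≠ 0 → f q = F (sqNormInf q))
    (hA0 : A (sqNormInf p) ≠ 0) (hB0 : B (sqNormInf p) ≠ 0) :
    laplacian g f p = 4 * (sqNormInf p * F2 (sqNormInf p) / A (sqNormInf p)
      + F1 (sqNormInf p) / A (sqNormInf p)
      + sqNormInf p * F1 (sqNormInf p) / B (sqNormInf p)) := by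
  have hev := eventually_fst_ne hp
  have hM := (normSq_fibre_pos p).ne'
  have hQ := (normSq_pos_of_ne hp).ne'
  have x1 := hasGrad_x1 p
  have y1 := hasGrad_y1 p
  have x2 := hasGrad_x2 p
  have y2 := hasGrad_y2 p
  have gM := hasGrad_fibre p
  have gQ := hasGrad_normSq_fst p
  have giQ := gQ.inv hQ
  have gMQ := (gM.mul (giQ.mul giQ)).congr_fun
    (g := fun q => (1 + q.2.re ^ 2 + q.2.im ^ 2) / (q.1.re ^ 2 + q.1.im ^ 2) ^ 2)
    fun q => by rw [div_eq_mul_inv, sq (q.1.re ^ 2 + q.1.im ^ 2), mul_inv]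
  have g2 := HasGrad.const (p := p) 2
  have hess := fun e a => pd_pd_comp (p := p) (h := sqNormInf)
    (W := ![_, _, _, _]) (hev.mono fun q hq => hasGrad_sqNormInf hq)
    (Fin.forall_fin_succ.2 ⟨((g2.mul x1).mul gMQ).neg, Fin.forall_fin_succ.2
      ⟨((g2.mul y1).mul gMQ).neg, Fin.forall_fin_succ.2 ⟨(g2.mul x2).mul giQ,
        Fin.forall_fin_succ.2 ⟨(g2.mul y2).mul giQ, fun i => i.elim0⟩⟩⟩⟩)
    (hev.mono fun q hq => hF _ (sqNormInf_pos hq)) (hF1 _ (sqNormInf_pos hp))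
    (hev.mono fun q hq => hf q hq) e a
  rw [laplacian_of_kahler hh (hdet p) hcl f hc]
  simp only [hess]
  generalize A (sqNormInf p) = a at *
  generalize B (sqNormInf p) = b at *
  generalize F1 (sqNormInf p) = f1
  generalize F2 (sqNormInf p) = f2
  simp only [sqNormInf]
  have hΔ : a * (1 + p.2.re ^ 2 + p.2.im ^ 2) / (p.1.re ^ 2 + p.1.im ^ 2) ^ 2
      * (a * (p.2.re ^ 2 + p.2.im ^ 2)
        / ((p.1.re ^ 2 + p.1.im ^ 2) * (1 + p.2.re ^ 2 + p.2.im ^ 2))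
        + b / (1 + p.2.re ^ 2 + p.2.im ^ 2) ^ 2)
      - (-(a * (p.1.re * p.2.re + p.1.im * p.2.im)) / (p.1.re ^ 2 + p.1.im ^ 2) ^ 2) ^ 2
      - (-(a * (p.1.re * p.2.im - p.1.im * p.2.re)) / (p.1.re ^ 2 + p.1.im ^ 2) ^ 2) ^ 2
      = a * b / ((p.1.re ^ 2 + p.1.im ^ 2) ^ 2 * (1 + p.2.re ^ 2 + p.2.im ^ 2)) := by
    field_simp
    ring
  rw [hΔ]
  simp
  field_simp
  ring

/-! ### Invariance under `U(2)` -/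

theorem fderiv_fibre_map {α m : ℂ → ℂ} {α' m' : ℂ} {p : CTwo} (hα : HasDerivAt α α' p.2)
    (hm : HasDerivAt m m' p.2) (v : CTwo) :
    fderiv ℝ (fun q : CTwo => (q.1 * α q.2, m q.2)) p v =
      (v.1 * α p.2 + p.1 * α' * v.2, m' * v.2) := by
  have h1 : HasFDerivAt (fun q : CTwo => α q.2) _ p :=
    hα.comp_hasFDerivAt p (hasFDerivAt_snd (𝕜 := ℂ))
  have h2 : HasFDerivAt (fun q : CTwo => m q.2) _ p :=
    hm.comp_hasFDerivAt p (hasFDerivAt_snd (𝕜 := ℂ))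
  have h3 := (((hasFDerivAt_fst (𝕜 := ℂ) (p := p)).mul h1).prodMk h2).restrictScalars ℝ
  have h4 : fderiv ℝ (fun q : CTwo => (q.1 * α q.2, m q.2)) p = _ := h3.fderiv
  rw [h4]
  refine Prod.ext ?_ ?_
  · simp; ring
  · simp

/-- A unitary matrix taking `u (1, v)` to `(√ρ, 0)`, where `ρ = |u|² (1 + |v|²)`; here `n` stands
for `√(1 + |v|²)` and `w` for `ū / |u|`. -/
def rotMatrix (n : ℝ) (w v : ℂ) : Matrix (Fin 2) (Fin 2) ℂ :=
  !![w / n, w * conj v / n; -v / n, 1 / n]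

theorem rotMatrix_mem {n : ℝ} {w v : ℂ} (hn : n ^ 2 = 1 + v.re ^ 2 + v.im ^ 2)
    (hw : w * conj w = 1) : rotMatrix n w v ∈ Matrix.unitaryGroup (Fin 2) ℂ := by
  have hn0 : (n : ℂ) ≠ 0 := by
    intro h
    have : n = 0 := by exact_mod_cast h
    nlinarith [sq_nonneg v.re, sq_nonneg v.im]
  have hv : v * conj v + 1 = (n : ℂ) ^ 2 := by
    rw [Complex.mul_conj, Complex.normSq_apply]
    norm_cast
    rw [hn]; ring
  rw [Matrix.mem_unitaryGroup_iff]
  ext i j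
  fin_cases i <;> fin_cases j <;>
    simp [rotMatrix, Matrix.mul_apply, Fin.sum_univ_two, Matrix.star_apply] <;> field_simp
  · linear_combination (v * conj v + 1) * hw + hv
  · ring
  · ring
  · linear_combination hv

theorem chartAct_rotMatrix {n : ℝ} (hn : n ≠ 0) (w v : ℂ) (q : CTwo) :
    chartAct (rotMatrix n w v) (0, 0) (0, 0) q =
      (q.1 * (w * (1 + conj v * q.2) / n), (q.2 - v) / (w * (1 + conj v * q.2))) := by
  have hn' : (n : ℂ) ≠ 0 := by exact_mod_cast hn
  refine Prod.ext ?_ ?_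
  · simp [chartAct, coord, act, lift, fibreVec, rotMatrix, dotProduct,
      Fin.sum_univ_two, Matrix.vecTail]
    ring
  · simp [chartAct, coord, act, lift, fibreVec, rotMatrix]
    have e1 : -v / (n : ℂ) + q.2 * (n : ℂ)⁻¹ = (q.2 - v) / n := by ring
    have e2 : w / (n : ℂ) + q.2 * (w * conj v / n) = w * (1 + conj v * q.2) / n := by ring
    rw [e1, e2, div_div_div_cancel_right₀ hn']

theorem chartAct_diag (q : CTwo) :
    chartAct !![1, 0; 0, -1] (0, 0) (0, 0) q = (q.1 * 1, -q.2) := by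
  refine Prod.ext ?_ ?_
  · simp [chartAct, coord, act, lift, fibreVec, dotProduct, Fin.sum_univ_two, Matrix.vecTail]
  · simp [chartAct, coord, act, lift, fibreVec]

theorem chartAct_swap (q : CTwo) : chartAct !![0, 1; 1, 0] (0, 0) (0, 1) q = q := by
  refine Prod.ext ?_ ?_
  · simp [chartAct, coord, act, lift, fibreVec, dotProduct, Fin.sum_univ_two, Matrix.vecTail]
  · simp [chartAct, coord, act, lift, fibreVec]

/-- A Hermitian form in terms of the four coefficients of its Gram matrix. -/
theorem apply_of_gram_eq {g : FormField} {p : CTwo} {H R I E : ℝ}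
    (hG : gram g p = hermMatrix H R I E) (v w : CTwo) :
    g p v w = H * (v.1.re * w.1.re + v.1.im * w.1.im) + E * (v.2.re * w.2.re + v.2.im * w.2.im)
      + R * (v.1.re * w.2.re + v.1.im * w.2.im + v.2.re * w.1.re + v.2.im * w.1.im)
      + I * (v.1.re * w.2.im - v.1.im * w.2.re + v.2.im * w.1.re - v.2.re * w.1.im) := by
  have h : ∀ a b, g p (frame a) (frame b) = hermMatrix H R I E a b := fun a b => by
    rw [← hG]; rfl
  rw [eq_sum_frame v, eq_sum_frame w]
  simp only [map_add, map_smul, add_apply, smul_apply, h,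
    smul_eq_mul]
  simp [hermMatrix, frame]
  ring

namespace Metric

/-- Interchanging `Z₁` and `Z₂` takes one chart at the exceptional curve to the other, without
changing the coordinates. -/
theorem form_swap {g : Metric} (hg : g.IsU2Invariant) : g.form (0, 1) = g.form (0, 0) := by
  have hmem : (!![0, 1; 1, 0] : Matrix (Fin 2) (Fin 2) ℂ) ∈ Matrix.unitaryGroup (Fin 2) ℂ := by
    rw [Matrix.mem_unitaryGroup_iff]
    ext i j
    fin_cases i <;> fin_cases j <;>
      simp [Matrix.mul_apply, Fin.sum_univ_two, Matrix.star_apply]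
  have hfun : chartAct !![0, 1; 1, 0] (0, 0) (0, 1) = fun q : CTwo => q :=
    funext chartAct_swap
  funext p
  refine ContinuousLinearMap.ext fun v => ContinuousLinearMap.ext fun w => ?_
  have hin : InChart (0, 1) (act !![0, 1; 1, 0] (lift (0, 0) p)) := by
    simp [InChart, act, lift, fibreVec]
  have key := hg _ hmem (0, 0) (0, 1) p hin v w
  rw [hfun] at key
  simpa using key.symm

/-- The values of an invariant Hermitian metric at the points `(z, 0)` are diagonal. -/
theorem gram_axis {g : Metric} (hg : g.IsU2Invariant) (hh : IsHermitianForm (g.form (0, 0)))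
    (z : ℂ) :
    gram (g.form (0, 0)) (z, 0) =
      hermMatrix (gram (g.form (0, 0)) (z, 0) 0 0) 0 0 (gram (g.form (0, 0)) (z, 0) 2 2) := by
  have hmem : (!![1, 0; 0, -1] : Matrix (Fin 2) (Fin 2) ℂ) ∈ Matrix.unitaryGroup (Fin 2) ℂ := by
    rw [Matrix.mem_unitaryGroup_iff]
    ext i j
    fin_cases i <;> fin_cases j <;>
      simp [Matrix.mul_apply, Fin.sum_univ_two, Matrix.star_apply]
  have hin : InChart (0, 0) (act !![1, 0; 0, -1] (lift (0, 0) (z, 0))) := by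
    simp [InChart, act, lift, fibreVec]
  have hfun : chartAct !![1, 0; 0, -1] (0, 0) (0, 0) = fun q : CTwo => (q.1 * 1, -q.2) :=
    funext chartAct_diag
  have hd := fun v => fderiv_fibre_map (α := fun _ => 1) (m := fun x => -x) (p := ((z, 0) : CTwo))
    (hasDerivAt_const _ _) (hasDerivAt_neg _) v
  have key : ∀ v w, g.form (0, 0) (z, 0) v w =
      g.form (0, 0) (z, 0) (v.1, -v.2) (w.1, -w.2) := fun v w => by
    have := hg _ hmem (0, 0) (0, 0) (z, 0) hin v w
    rw [hfun] at this
    simp only [hd] at this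
    simpa only [neg_zero, mul_one, mul_zero, zero_mul, add_zero, neg_mul, one_mul] using this
  have e0 : ((frame 0).1, -(frame 0).2) = frame 0 := by simp [frame]
  have e2 : ((frame 2).1, -(frame 2).2) = -frame 2 := by simp [frame]
  have e3 : ((frame 3).1, -(frame 3).2) = -frame 3 := by simp [frame]
  have k02 := key (frame 0) (frame 2)
  have k03 := key (frame 0) (frame 3)
  rw [e0, e2, map_neg] at k02
  rw [e0, e3, map_neg] at k03
  have g02 : gram (g.form (0, 0)) (z, 0) 0 2 = 0 := by
    change g.form (0, 0) (z, 0) (frame 0) (frame 2) = 0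
    linarith
  have g03 : gram (g.form (0, 0)) (z, 0) 0 3 = 0 := by
    change g.form (0, 0) (z, 0) (frame 0) (frame 3) = 0
    linarith
  conv_lhs => rw [gram_eq_hermMatrix hh, g02, g03]

/-- An invariant Hermitian metric is of Calabi type, with coefficients read off on the axis
`v = 0`. -/
theorem isCalabi {g : Metric} (hg : g.IsU2Invariant) (hh : IsHermitianForm (g.form (0, 0))) :
    IsCalabi (g.form (0, 0)) (fun x => gram (g.form (0, 0)) ((√x : ℝ), 0) 0 0)
      (fun x => gram (g.form (0, 0)) ((√x : ℝ), 0) 2 2) := by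
  intro p hp
  set n := √(1 + p.2.re ^ 2 + p.2.im ^ 2) with hn
  have hn2 : n ^ 2 = 1 + p.2.re ^ 2 + p.2.im ^ 2 := Real.sq_sqrt (normSq_fibre_pos p).le
  have hn0 : 0 < n := Real.sqrt_pos.2 (normSq_fibre_pos p)
  have hnC : (n : ℂ) ≠ 0 := by exact_mod_cast hn0.ne'
  set w : ℂ := conj p.1 / ‖p.1‖ with hw
  have hu : (‖p.1‖ : ℂ) ≠ 0 := by exact_mod_cast norm_ne_zero_iff.2 hp
  have hpp : p.1 * conj p.1 = (‖p.1‖ : ℂ) ^ 2 := Complex.mul_conj' p.1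
  have hw1 : w * conj w = 1 := by
    simp only [hw, map_div₀, Complex.conj_conj, Complex.conj_ofReal]
    field_simp
    linear_combination hpp
  have hw0 : w ≠ 0 := left_ne_zero_of_mul (hw1.trans_ne one_ne_zero)
  have hv : conj p.2 * p.2 + 1 = (n : ℂ) ^ 2 := by
    rw [mul_comm, Complex.mul_conj, Complex.normSq_apply]
    norm_cast
    rw [hn2]; ring
  have hM0 : 1 + conj p.2 * p.2 ≠ 0 := by
    rw [add_comm, hv]; exact pow_ne_zero 2 hnC
  have hin : InChart (0, 0) (act (rotMatrix n w p.2) (lift (0, 0) p)) := by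
    have : w / (n : ℂ) + p.2 * (w * conj p.2 / n) = w * (1 + conj p.2 * p.2) / n := by ring
    simp [InChart, act, lift, fibreVec, rotMatrix, this, hw0, hnC, hM0]
  have hfun : chartAct (rotMatrix n w p.2) (0, 0) (0, 0) = fun q : CTwo =>
      (q.1 * (w * (1 + conj p.2 * q.2) / n), (q.2 - p.2) / (w * (1 + conj p.2 * q.2))) :=
    funext (chartAct_rotMatrix hn0.ne' w p.2)
  have hα : HasDerivAt (fun x : ℂ => w * (1 + conj p.2 * x) / n) (w * conj p.2 / n) p.2 := by
    have := ((((hasDerivAt_id p.2).const_mul (conj p.2)).const_add 1).const_mul w).div_const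
      (n : ℂ)
    simpa using this
  have hm : HasDerivAt (fun x : ℂ => (x - p.2) / (w * (1 + conj p.2 * x)))
      (1 / (w * (n : ℂ) ^ 2)) p.2 := by
    have h1 := (((hasDerivAt_id p.2).const_mul (conj p.2)).const_add 1).const_mul w
    have h2 := ((hasDerivAt_id p.2).sub_const p.2).div h1 (mul_ne_zero hw0 hM0)
    refine h2.congr_deriv ?_
    simp only [id, sub_self, zero_mul, sub_zero, one_mul]
    field_simp
    linear_combination -hv
  have hρ : sqNorm p = (‖p.1‖ * n) ^ 2 := by
    have h1 : ‖p.1‖ ^ 2 = p.1.re ^ 2 + p.1.im ^ 2 := by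
      rw [← Complex.normSq_eq_norm_sq, Complex.normSq_apply]; ring
    rw [mul_pow, h1, hn2, sqNorm]
  have hr : √(sqNorm p) = ‖p.1‖ * n := by
    rw [hρ]; exact Real.sqrt_sq (by positivity)
  have hpt : chartAct (rotMatrix n w p.2) (0, 0) (0, 0) p =
      (((√(sqNorm p) : ℝ) : ℂ), (0 : ℂ)) := by
    rw [hfun, hr]
    refine Prod.ext ?_ (by simp)
    simp only [hw]
    rw [add_comm 1, hv]
    push_cast
    field_simp
    linear_combination hpp
  have key := hg _ (rotMatrix_mem hn2 hw1) (0, 0) (0, 0) p hin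
  simp only [hpt] at key
  rw [hfun] at key
  simp only [fderiv_fibre_map hα hm, apply_of_gram_eq (gram_axis hg hh _)] at key
  -- the pulled-back metric in terms of `θ = N ξ₁ + u v̄ ξ₂ / N`
  have hre : ∀ x y : ℂ, x.re * y.re + x.im * y.im = (x * conj y).re := fun x y => by simp
  have h1 : ∀ v : CTwo, v.1 * (w * (1 + conj p.2 * p.2) / n) + p.1 * (w * conj p.2 / n) * v.2
      = w * (n * v.1 + p.1 * conj p.2 * v.2 / n) := fun v => by
    rw [add_comm 1, hv]
    field_simp
  have h2 : ∀ x y : ℂ, (w * x) * conj (w * y) = x * conj y := fun x y => by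
    rw [map_mul]; linear_combination (x * conj y) * hw1
  have h3 : ∀ x y : ℂ, (1 / (w * (n : ℂ) ^ 2) * x) * conj (1 / (w * (n : ℂ) ^ 2) * y)
      = x * conj y / ((n ^ 4 : ℝ) : ℂ) := fun x y => by
    have hw0' : conj w ≠ 0 := right_ne_zero_of_mul (hw1.trans_ne one_ne_zero)
    simp only [map_mul, map_div₀, map_one, map_pow, Complex.conj_ofReal]
    push_cast
    field_simp
    linear_combination (-x * conj y) * hw1
  simp only [hre, h1, h2, h3, Complex.div_ofReal_re, zero_mul, add_zero] at key
  set a := gram (g.form (0, 0)) (((√(sqNorm p) : ℝ) : ℂ), 0) 0 0 with ha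
  set b := gram (g.form (0, 0)) (((√(sqNorm p) : ℝ) : ℂ), 0) 2 2 with hb
  have k00 : gram (g.form (0, 0)) p 0 0 = _ := key (frame 0) (frame 0)
  have k02 : gram (g.form (0, 0)) p 0 2 = _ := key (frame 0) (frame 2)
  have k03 : gram (g.form (0, 0)) p 0 3 = _ := key (frame 0) (frame 3)
  have k22 : gram (g.form (0, 0)) p 2 2 = _ := key (frame 2) (frame 2)
  rw [gram_eq_hermMatrix hh, calabiMatrix_eq, k00, k02, k03, k22]
  congr 1
  · simp [-mul_eq_mul_left_iff, frame, calabiMatrix, ← ha, ← hn2]; ring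
  · simp [-mul_eq_mul_left_iff, frame, calabiMatrix, ← ha]; field_simp
  · simp [-mul_eq_mul_left_iff, frame, calabiMatrix, ← ha]; field_simp; ring
  · simp [-mul_eq_mul_left_iff, frame, calabiMatrix, ← ha, ← hb, ← hn2]; field_simp; ring

end Metric

/-! ### The conformal factor of a conformally Kähler metric of Calabi type -/

/-- If `s g` is Kähler and `g` is of Calabi type, then `ds` is proportional to `dρ`. This solves
the linear equation `ds ∧ ω = -s dω` for `ds`. -/
theorem grad_conformal_factor {g k : FormField} {A A1 B B1 : ℝ → ℝ} (hc : IsCalabi g A B)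
    (hA : ∀ x, 0 < x → HasDerivAt A (A1 x) x) (hB : ∀ x, 0 < x → HasDerivAt B (B1 x) x)
    {s : CTwo → ℝ} {d : Fin 4 → ℝ} {p : CTwo} (hp : p.1 ≠ 0) (hs : HasGrad s d p)
    (hk : ∀ q a b, gram k q a b = s q * gram g q a b) (hcl : IsClosedAt k p)
    (hA0 : A (sqNorm p) ≠ 0) (a : Fin 4) :
    B (sqNorm p) * d a = s p * (A (sqNorm p) - B1 (sqNorm p)) * pd a sqNorm p := by
  have hM := (normSq_fibre_pos p).ne'
  have hent : ∀ {a b e}, HasGrad (fun q => calabiMatrix A B q a b) e p →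
      HasGrad (fun q => gram k q a b) (fun c => d c * calabiMatrix A B p a b + s p * e c) p :=
    fun {a b e} h => (hs.mul h).congr_eventually <| by
      filter_upwards [eventually_fst_ne hp] with q hq
      rw [hk, hc q hq]
  have hH := (hent (hasGrad_calabi_H (B := B) hA hp)).2
  have hR := (hent (hasGrad_calabi_R (B := B) hA hp)).2
  have hI := (hent (hasGrad_calabi_I (B := B) hA hp)).2
  have hE := (hent (hasGrad_calabi_E hA hB hp)).2
  obtain ⟨c1, c2, c3, c4⟩ := hcl
  rw [hH, hR, hI] at c1 c2
  rw [hE, hR, hI] at c3 c4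
  rw [(hasGrad_sqNorm p).2]
  simp only [Matrix.cons_val_zero, Matrix.cons_val_one, Matrix.cons_val] at c1 c2 c3 c4
  set H := calabiMatrix A B p 0 0 with hHd
  set R := calabiMatrix A B p 0 2 with hRd
  set I := calabiMatrix A B p 0 3 with hId
  set E := calabiMatrix A B p 2 2 with hEd
  simp [calabiMatrix] at hHd hRd hId hEd
  generalize A (sqNorm p) = α at *
  generalize B (sqNorm p) = β at *
  generalize A1 (sqNorm p) = α' at *
  generalize B1 (sqNorm p) = β' at *
  simp only [sqNorm] at *
  fin_cases a <;> simp [-mul_eq_mul_left_iff]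
  · have := congrArg₂ (· + ·) (congrArg₂ (· + ·) (congrArg (H * ·) c3) (congrArg (R * ·) c1))
      (congrArg (I * ·) c2)
    rw [hHd, hRd, hId, hEd] at this
    field_simp at this
    linear_combination this
  · have := congrArg₂ (· + ·) (congrArg₂ (· + ·) (congrArg (H * ·) c4) (congrArg (-I * ·) c1))
      (congrArg (R * ·) c2)
    rw [hHd, hRd, hId, hEd] at this
    field_simp at this
    linear_combination this
  · have := congrArg₂ (· + ·) (congrArg₂ (· + ·) (congrArg (E * ·) c1) (congrArg (R * ·) c3))
      (congrArg (-I * ·) c4)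
    rw [hHd, hRd, hId, hEd] at this
    field_simp at this
    exact mul_left_cancel₀ (mul_ne_zero hA0 hM) (by linear_combination this)
  · have := congrArg₂ (· + ·) (congrArg₂ (· + ·) (congrArg (E * ·) c2) (congrArg (I * ·) c3))
      (congrArg (R * ·) c4)
    rw [hHd, hRd, hId, hEd] at this
    field_simp at this
    exact mul_left_cancel₀ (mul_ne_zero hA0 hM) (by linear_combination this)

/-- A function on `u ≠ 0` whose differential is proportional to `dρ` is a function of `ρ`: any
point is joined to `(√ρ, 0)` by a path in a level set of `ρ`. -/
theorem eq_axis_of_grad_proportional {s : CTwo → ℝ}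
    (hs : ∀ p : CTwo, p.1 ≠ 0 → DifferentiableAt ℝ s p)
    (hd : ∀ p : CTwo, p.1 ≠ 0 → ∃ t : ℝ, ∀ a, pd a s p = t * pd a sqNorm p)
    {p : CTwo} (hp : p.1 ≠ 0) : s p = s (((√(sqNorm p) : ℝ) : ℂ), 0) := by
  set m : ℝ → ℝ := fun t => 1 + t ^ 2 * (p.2.re ^ 2 + p.2.im ^ 2) with hm
  have hm0 : ∀ t, 0 < m t := fun t => by positivity
  set φ := Complex.arg p.1
  set γ : ℝ → CTwo := fun t =>
    (((√(sqNorm p) / √(m t) : ℝ) : ℂ) * Complex.exp ((t * φ : ℝ) * Complex.I), (t : ℂ) * p.2)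
    with hγ
  have hQ : ‖p.1‖ ^ 2 = p.1.re ^ 2 + p.1.im ^ 2 := by
    rw [← Complex.normSq_eq_norm_sq, Complex.normSq_apply]; ring
  have hγ1 : ∀ t, (γ t).1 ≠ 0 := fun t => by
    refine mul_ne_zero ?_ (Complex.exp_ne_zero _)
    exact_mod_cast (div_pos (Real.sqrt_pos.2 (sqNorm_pos hp)) (Real.sqrt_pos.2 (hm0 t))).ne'
  have hρ : ∀ t, sqNorm (γ t) = sqNorm p := fun t => by
    have h1 : (γ t).1.re ^ 2 + (γ t).1.im ^ 2 = sqNorm p / m t := by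
      have : (γ t).1.re ^ 2 + (γ t).1.im ^ 2 = ‖(γ t).1‖ ^ 2 := by
        rw [← Complex.normSq_eq_norm_sq, Complex.normSq_apply]; ring
      rw [this, hγ, norm_mul, Complex.norm_exp_ofReal_mul_I, mul_one, Complex.norm_real,
        Real.norm_eq_abs, sq_abs, div_pow, Real.sq_sqrt (sqNorm_pos hp).le,
        Real.sq_sqrt (hm0 t).le]
    have h2 : 1 + (γ t).2.re ^ 2 + (γ t).2.im ^ 2 = m t := by
      simp [hγ, hm]; ring
    rw [sqNorm, h1, h2, div_mul_cancel₀ _ (hm0 t).ne']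
  have hmd : Differentiable ℝ m := by fun_prop
  have hγd : Differentiable ℝ γ := by
    refine Differentiable.prodMk (Differentiable.mul ?_ ?_) (by fun_prop)
    · refine Complex.ofRealCLM.differentiable.comp ?_
      exact (differentiable_const _).div (hmd.sqrt fun t => (hm0 t).ne')
        fun t => (Real.sqrt_pos.2 (hm0 t)).ne'
    · fun_prop
  have hderiv : ∀ t, deriv (fun t => s (γ t)) t = 0 := fun t => by
    obtain ⟨c, hc⟩ := hd (γ t) (hγ1 t)
    have h1 : HasDerivAt (fun t => s (γ t)) (fderiv ℝ s (γ t) (deriv γ t)) t :=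
      (hs _ (hγ1 t)).hasFDerivAt.comp_hasDerivAt t (hγd t).hasDerivAt
    have h2 : HasDerivAt (fun t => sqNorm (γ t)) (fderiv ℝ sqNorm (γ t) (deriv γ t)) t :=
      (hasGrad_sqNorm _).1.hasFDerivAt.comp_hasDerivAt t (hγd t).hasDerivAt
    have h3 : HasDerivAt (fun t => sqNorm (γ t)) 0 t := by
      simp only [hρ]; exact hasDerivAt_const _ _
    have h4 := h2.unique h3
    rw [h1.deriv, fderiv_eq_sum_pd, hc, hc, hc, hc]
    rw [fderiv_eq_sum_pd] at h4
    linear_combination c * h4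
  have hdiff : Differentiable ℝ (fun t => s (γ t)) := fun t =>
    (hs _ (hγ1 t)).comp t (hγd t)
  have hconst := is_const_of_deriv_eq_zero hdiff hderiv 1 0
  have e1 : γ 1 = p := by
    have hr : √(sqNorm p) / √(m 1) = ‖p.1‖ := by
      have : sqNorm p = ‖p.1‖ ^ 2 * m 1 := by rw [hQ, sqNorm, hm]; ring
      rw [this, Real.sqrt_mul (by positivity), Real.sqrt_sq (norm_nonneg _),
        mul_div_cancel_right₀ _ (Real.sqrt_pos.2 (hm0 1)).ne']
    refine Prod.ext ?_ (by simp [hγ])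
    simp only [hγ, hr, one_mul]
    exact Complex.norm_mul_exp_arg_mul_I p.1
  have e0 : γ 0 = (((√(sqNorm p) : ℝ) : ℂ), 0) := by simp [hγ, hm]
  simp only [e1, e0] at hconst
  exact hconst

/-! ### Reduction to functions of one variable -/

/-- The diagonal entries of the Gram matrix at `(√x, 0)`, as functions of `x = ρ`. -/
def radial (g : FormField) (i : Fin 4) (x : ℝ) : ℝ := gram g (((√x : ℝ) : ℂ), 0) i i

theorem contDiff_axis {f : CTwo → ℝ} (hf : ContDiff ℝ ∞ f) :
    ContDiff ℝ ∞ (fun r : ℝ => f ((r : ℂ), 0)) :=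
  hf.comp (Complex.ofRealCLM.contDiff.prodMk contDiff_const)

theorem contDiffOn_radial {g : FormField} (hg : ContDiff ℝ ∞ g) (i : Fin 4) :
    ContDiffOn ℝ ∞ (radial g i) (Set.Ioi 0) := fun x hx =>
  ((contDiff_axis (contDiff_gram hg i i)).contDiffAt.comp x
    (Real.contDiffAt_sqrt (ne_of_gt hx))).contDiffWithinAt

theorem hasDerivAt_of_contDiffOn_Ioi {f : ℝ → ℝ} (hf : ContDiffOn ℝ ∞ f (Set.Ioi 0)) {x : ℝ}
    (hx : 0 < x) : HasDerivAt f (deriv f x) x :=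
  ((hf.contDiffAt (Ioi_mem_nhds hx)).differentiableAt (by simp)).hasDerivAt

theorem contDiffOn_deriv_Ioi {f : ℝ → ℝ} (hf : ContDiffOn ℝ ∞ f (Set.Ioi 0)) :
    ContDiffOn ℝ ∞ (deriv f) (Set.Ioi 0) :=
  hf.deriv_of_isOpen isOpen_Ioi (m := ∞) (by simp)

namespace Metric

theorem det_gram_ne (g : Metric) (c : ChartIx) (p : CTwo) : (gram (g.form c) p).det ≠ 0 := by
  intro h
  obtain ⟨v, hv, hv0⟩ := Matrix.exists_mulVec_eq_zero_iff.2 h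
  set x : CTwo := ∑ i, v i • frame i with hx
  have hx0 : x ≠ 0 := by
    intro h0
    apply hv
    rw [hx, Fin.sum_univ_four] at h0
    have h1 := congrArg Prod.fst h0
    have h2 := congrArg Prod.snd h0
    have h1r := congrArg Complex.re h1
    have h1i := congrArg Complex.im h1
    have h2r := congrArg Complex.re h2
    have h2i := congrArg Complex.im h2
    simp [frame] at h1r h1i h2r h2i
    ext i; fin_cases i <;> simpa
  have h1 : g.form c p x x = v ⬝ᵥ (gram (g.form c) p *ᵥ v) := by
    rw [hx]
    simp only [Fin.sum_univ_four, map_add, map_smul, add_apply, smul_apply, smul_eq_mul,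
      dotProduct, Matrix.mulVec, gram, Matrix.of_apply]
    ring
  have h2 := g.pos c p x hx0
  rw [h1, hv0, dotProduct_zero] at h2
  exact lt_irrefl _ h2

theorem gram_diag_pos (g : Metric) (c : ChartIx) (p : CTwo) (i : Fin 4) :
    0 < gram (g.form c) p i i := by
  refine g.pos c p _ ?_
  fin_cases i <;> simp [frame, Prod.ext_iff]

section Rescaling

variable {k g : Metric}

theorem IsScalRescaling.scal_pos (h : g.IsScalRescaling k) (c : ChartIx) (p : CTwo) :
    0 < scal (k.form c) p := h.1 (c, p)

theorem IsScalRescaling.form_eq (h : g.IsScalRescaling k) (c : ChartIx) (p v w : CTwo) :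
    k.form c p v w = scal (k.form c) p ^ 2 * g.form c p v w := by
  have h0 := (h.scal_pos c p).ne'
  rw [h.2 c p]
  simp only [smul_apply, smul_eq_mul]
  field_simp

theorem IsScalRescaling.gram_eq (h : g.IsScalRescaling k) (c : ChartIx) (p : CTwo) (a b : Fin 4) :
    gram (k.form c) p a b = scal (k.form c) p ^ 2 * gram (g.form c) p a b :=
  h.form_eq c p _ _

theorem IsScalRescaling.isHermitianForm (h : g.IsScalRescaling k) (hk : k.IsKahler)
    (c : ChartIx) : IsHermitianForm (g.form c) := by
  refine ⟨g.symm c, fun p v w => ?_⟩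
  have := (isHermitianForm_of_isKahler hk c).2 p v w
  rw [h.form_eq, h.form_eq] at this
  exact mul_left_cancel₀ (pow_ne_zero 2 (h.scal_pos c p).ne') this

/-- The square of the conformal factor is a quotient of metric coefficients, hence smooth. -/
theorem IsScalRescaling.contDiff_sq (h : g.IsScalRescaling k) (c : ChartIx) :
    ContDiff ℝ ∞ (fun p => scal (k.form c) p ^ 2) := by
  have : (fun p => scal (k.form c) p ^ 2) =
      fun p => gram (k.form c) p 0 0 / gram (g.form c) p 0 0 := by
    funext p
    rw [h.gram_eq, mul_div_cancel_right₀ _ (g.gram_diag_pos c p 0).ne']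
  rw [this]
  exact (contDiff_gram (k.smooth c) 0 0).div (contDiff_gram (g.smooth c) 0 0)
    fun p => (g.gram_diag_pos c p 0).ne'

/-- The scalar curvature of `k` is a function on the blow-up: both `k` and `g = s⁻² k` are. -/
theorem IsScalRescaling.scal_transition (h : g.IsScalRescaling k) {c d : ChartIx} {p : CTwo}
    (hin : InChart d (lift c p)) :
    scal (k.form c) p = scal (k.form d) (transition c d p) := by
  have h1 := k.compat c d p hin (frame 0) (frame 0)
  have h2 := g.compat c d p hin (frame 0) (frame 0)
  rw [h.form_eq, h.form_eq, ← h2] at h1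
  have h3 := mul_right_cancel₀ (g.gram_diag_pos c p 0).ne' h1
  exact (pow_left_inj₀ (h.scal_pos _ _).le (h.scal_pos _ _).le two_ne_zero).1 h3

theorem form_zero_eq (hg : g.IsU2Invariant) (l : Fin 2) : g.form (0, l) = g.form (0, 0) := by
  fin_cases l
  · rfl
  · exact form_swap hg

theorem isCalabi_radial (h : g.IsScalRescaling k) (hk : k.IsKahler) (hg : g.IsU2Invariant)
    (l : Fin 2) :
    IsCalabi (g.form (0, l)) (radial (g.form (0, 0)) 0) (radial (g.form (0, 0)) 2) := by
  rw [form_zero_eq hg]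
  exact isCalabi hg (h.isHermitianForm hk _)

/-- The scalar curvature of `k` depends on `ρ` only: `k` is Kähler and conformal to a metric of
Calabi type. -/
theorem scal_axis_eq (h : g.IsScalRescaling k) (hk : k.IsKahler) (hg : g.IsU2Invariant)
    (l : Fin 2) {p : CTwo} (hp : p.1 ≠ 0) :
    scal (k.form (0, l)) p = scal (k.form (0, l)) (((√(sqNorm p) : ℝ) : ℂ), 0) := by
  have hsm := h.contDiff_sq (0, l)
  have := eq_axis_of_grad_proportional (s := fun p => scal (k.form (0, l)) p ^ 2)
    (fun p _ => hsm.differentiable (by simp) p) (fun q hq => ?_) hp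
  · exact (pow_left_inj₀ (h.scal_pos _ _).le (h.scal_pos _ _).le two_ne_zero).1 this
  · set A := radial (g.form (0, 0)) 0 with hA
    set B := radial (g.form (0, 0)) 2 with hB
    have hB0 : B (sqNorm q) ≠ 0 := (g.gram_diag_pos _ _ 2).ne'
    refine ⟨scal (k.form (0, l)) q ^ 2 * (A (sqNorm q) - deriv B (sqNorm q)) / B (sqNorm q),
      fun a => ?_⟩
    have := grad_conformal_factor (isCalabi_radial h hk hg l)
      (fun x hx => hasDerivAt_of_contDiffOn_Ioi (contDiffOn_radial (g.smooth _) 0) hx)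
      (fun x hx => hasDerivAt_of_contDiffOn_Ioi (contDiffOn_radial (g.smooth _) 2) hx) hq
      (hasGrad_of_contDiff hsm q) (h.gram_eq (0, l)) (isClosedAt_of_isKahler hk _ q)
      (g.gram_diag_pos _ _ 0).ne' a
    rw [div_mul_eq_mul_div, eq_div_iff hB0, mul_comm]
    exact this

/-- The scalar curvature of `k` as a function of `ρ`. -/
def radialScal (k : Metric) (x : ℝ) : ℝ := scal (k.form (0, 0)) (((√x : ℝ) : ℂ), 0)

theorem scal_eq_radialScal (h : g.IsScalRescaling k) (hk : k.IsKahler) (hg : g.IsU2Invariant)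
    (l : Fin 2) {p : CTwo} (hp : p.1 ≠ 0) :
    scal (k.form (0, l)) p = k.radialScal (sqNorm p) := by
  have h0 : ∀ {p : CTwo}, p.1 ≠ 0 → scal (k.form (0, 0)) p = k.radialScal (sqNorm p) :=
    fun hp => scal_axis_eq h hk hg 0 hp
  -- the coordinate change between the two charts fixes the points `(u, 1)`
  set q : CTwo := (((√(sqNorm p / 2) : ℝ) : ℂ), 1) with hq
  have hq0 : 0 < √(sqNorm p / 2) := Real.sqrt_pos.2 (half_pos (sqNorm_pos hp))
  have hq1 : q.1 ≠ 0 := by simpa [hq] using hq0.ne'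
  have hqρ : sqNorm q = sqNorm p := by
    simp [hq, sqNorm]
    rw [← sqNorm, div_pow, Real.sq_sqrt (sqNorm_pos hp).le, Real.sq_sqrt zero_le_two]; ring
  have ht : transition (0, 0) (0, l) q = q := by
    fin_cases l <;> refine Prod.ext ?_ ?_ <;> simp [transition, coord, lift, fibreVec, hq]
  have hin : InChart (0, l) (lift (0, 0) q) := by
    fin_cases l <;> simp [InChart, lift, fibreVec, hq]
  have h1 := h.scal_transition hin
  rw [ht, h0 hq1, hqρ, scal_axis_eq h hk hg l hq1, hqρ] at h1
  rw [scal_axis_eq h hk hg l hp, h1]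

theorem radial_eq (h : g.IsScalRescaling k) (i : Fin 4) (x : ℝ) :
    radial (k.form (0, 0)) i x = k.radialScal x ^ 2 * radial (g.form (0, 0)) i x :=
  h.gram_eq _ _ _ _

/-- Although no invariance of `k` is assumed, it is of Calabi type, being a multiple of `g` by a
function of `ρ`. -/
theorem isCalabi_radial_kahler (h : g.IsScalRescaling k) (hk : k.IsKahler)
    (hg : g.IsU2Invariant) (l : Fin 2) :
    IsCalabi (k.form (0, l)) (radial (k.form (0, 0)) 0) (radial (k.form (0, 0)) 2) := by
  intro p hp
  ext a b
  rw [h.gram_eq, scal_eq_radialScal h hk hg l hp, isCalabi_radial h hk hg l p hp]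
  fin_cases a <;> fin_cases b <;> simp [calabiMatrix, radial_eq h] <;> ring

theorem transition_inf (l : Fin 2) (q : CTwo) : transition (1, l) (0, l) q = (1 / q.1, q.2) := by
  fin_cases l <;> refine Prod.ext ?_ ?_ <;> simp [transition, coord, lift, fibreVec]

theorem inChart_inf (l : Fin 2) {p : CTwo} (hp : p.1 ≠ 0) : InChart (0, l) (lift (1, l) p) := by
  fin_cases l <;> simp [InChart, lift, fibreVec, hp]

theorem sqNorm_inv {p : CTwo} (hp : p.1 ≠ 0) : sqNorm (1 / p.1, p.2) = sqNormInf p := by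
  have hQ := (normSq_pos_of_ne hp).ne'
  have : (1 / p.1).re ^ 2 + (1 / p.1).im ^ 2 = (p.1.re ^ 2 + p.1.im ^ 2)⁻¹ := by
    simp [Complex.inv_re, Complex.inv_im, Complex.normSq_apply]
    field_simp
  rw [sqNorm, sqNormInf]
  simp only [this]
  rw [mul_comm, div_eq_mul_inv]

theorem scal_inf (h : g.IsScalRescaling k) (hk : k.IsKahler) (hg : g.IsU2Invariant)
    (l : Fin 2) {p : CTwo} (hp : p.1 ≠ 0) :
    scal (k.form (1, l)) p = k.radialScal (sqNormInf p) := by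
  rw [h.scal_transition (inChart_inf l hp), transition_inf,
    scal_eq_radialScal h hk hg l (by simpa using hp), sqNorm_inv hp]

/-- The metric `k` in the charts at the line at infinity, off that line. -/
theorem gram_inf (h : g.IsScalRescaling k) (hk : k.IsKahler) (hg : g.IsU2Invariant)
    (l : Fin 2) {p : CTwo} (hp : p.1 ≠ 0) :
    gram (k.form (1, l)) p =
      calabiMatrixInf (radial (k.form (0, 0)) 0) (radial (k.form (0, 0)) 2) p := by
  have hQ := (normSq_pos_of_ne hp).ne'
  have hM := (normSq_fibre_pos p).ne'
  have hfun : transition (1, l) (0, l) = fun q : CTwo => (1 / q.1, q.2) :=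
    funext (transition_inf l)
  have hd : ∀ v, fderiv ℝ (fun q : CTwo => (1 / q.1, q.2)) p v = (-(1 / p.1 ^ 2) * v.1, v.2) := by
    intro v
    have h1 : HasFDerivAt (fun q : CTwo => 1 / q.1) _ p :=
      (((hasDerivAt_inv hp).congr_of_eventuallyEq
        (Eventually.of_forall fun x => one_div x)).comp_hasFDerivAt p
        (hasFDerivAt_fst (𝕜 := ℂ) (p := p)))
    have h2 := (h1.prodMk (hasFDerivAt_snd (𝕜 := ℂ) (p := p))).restrictScalars ℝ
    have h3 : fderiv ℝ (fun q : CTwo => (1 / q.1, q.2)) p = _ := h2.fderiv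
    rw [h3]
    refine Prod.ext ?_ ?_ <;> simp
  have hp' : ((1 / p.1, p.2) : CTwo).1 ≠ 0 := by simpa using hp
  have key := k.compat (1, l) (0, l) p (inChart_inf l hp)
  rw [hfun] at key
  simp only [hd, apply_of_gram_eq ((isCalabi_radial_kahler h hk hg l _ hp').trans
    (calabiMatrix_eq _ _ _))] at key
  have k00 : gram (k.form (1, l)) p 0 0 = _ := key (frame 0) (frame 0)
  have k02 : gram (k.form (1, l)) p 0 2 = _ := key (frame 0) (frame 2)
  have k03 : gram (k.form (1, l)) p 0 3 = _ := key (frame 0) (frame 3)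
  have k22 : gram (k.form (1, l)) p 2 2 = _ := key (frame 2) (frame 2)
  rw [gram_eq_hermMatrix (isHermitianForm_of_isKahler hk _), calabiMatrixInf, k00, k02, k03, k22]
  simp only [calabiMatrix, sqNorm_inv hp]
  clear key k00 k02 k03 k22
  generalize radial (k.form (0, 0)) 0 (sqNormInf p) = a
  generalize radial (k.form (0, 0)) 2 (sqNormInf p) = b
  have hre : (p.1⁻¹).re = p.1.re / (p.1.re ^ 2 + p.1.im ^ 2) := by
    rw [Complex.inv_re, Complex.normSq_apply, sq, sq]
  have him : (p.1⁻¹).im = -p.1.im / (p.1.re ^ 2 + p.1.im ^ 2) := by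
    rw [Complex.inv_im, Complex.normSq_apply, sq, sq]
  congr 1
  all_goals
    simp [-mul_eq_mul_left_iff, frame, sq p.1, hre, him]
    field_simp
    try ring

end Rescaling

end Metric

/-! ### The differential equations for the momentum profile -/

/-- If `z ↦ c(|z|²) z` with `c` real is holomorphic, then `c` is constant: rotating `z` shows that
the derivative at `r > 0` is `c(r²)`. -/
theorem const_of_holomorphic_radial {h : ℂ → ℂ} (hh : Differentiable ℂ h) {c : ℝ → ℝ}
    (hc : ∀ z : ℂ, z ≠ 0 → h z = c (z.re ^ 2 + z.im ^ 2) * z) :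
    ∃ α : ℝ, ∀ x, 0 < x → c x = α := by
  have hcr : ∀ r : ℝ, 0 < r → h r = c (r ^ 2) * r := fun r hr => by
    have := hc r (by exact_mod_cast hr.ne')
    simpa using this
  have hd : ∀ r : ℝ, 0 < r → deriv h r = c (r ^ 2) := by
    intro r hr
    have hr0 : (r : ℂ) ≠ 0 := by exact_mod_cast hr.ne'
    set e : ℝ → ℂ := fun t => (r : ℂ) * Complex.exp ((t : ℂ) * Complex.I) with he
    have h1 : HasDerivAt e ((r : ℂ) * Complex.I) 0 := by
      have := ((((hasDerivAt_id (0 : ℂ)).mul_const Complex.I).cexp).const_mul (r : ℂ)).comp_ofReal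
      simpa [he] using this
    have h2 : HasDerivAt (fun t => h (e t)) ((r : ℂ) * Complex.I * deriv h r) 0 := by
      have e0 : e 0 = r := by simp [he]
      have := (hh (e 0)).hasDerivAt.scomp 0 h1
      rw [e0] at this
      exact this.congr_deriv (by simp)
    have h3 : ∀ t, h (e t) = c (r ^ 2) * e t := fun t => by
      have h4 : (e t).re ^ 2 + (e t).im ^ 2 = r ^ 2 := by
        have : (e t).re ^ 2 + (e t).im ^ 2 = ‖e t‖ ^ 2 := by
          rw [← Complex.normSq_eq_norm_sq, Complex.normSq_apply]; ring
        rw [this, he, norm_mul, Complex.norm_exp_ofReal_mul_I, mul_one, Complex.norm_real,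
          Real.norm_eq_abs, sq_abs]
      rw [hc _ (mul_ne_zero hr0 (Complex.exp_ne_zero _)), h4]
    have h5 : HasDerivAt (fun t => h (e t)) (c (r ^ 2) * ((r : ℂ) * Complex.I)) 0 := by
      simp only [h3]
      exact h1.const_mul _
    have h6 := h2.unique h5
    refine mul_left_cancel₀ (mul_ne_zero hr0 Complex.I_ne_zero) ?_
    rw [h6]; ring
  have hconst : ∀ r : ℝ, 0 < r → HasDerivAt (fun t : ℝ => h t / t) 0 r := by
    intro r hr
    have hr0 : (r : ℂ) ≠ 0 := by exact_mod_cast hr.ne'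
    have := (((hh r).hasDerivAt.fun_div (hasDerivAt_id (r : ℂ)) hr0)).comp_ofReal
    refine this.congr_deriv ?_
    simp [hd r hr, hcr r hr]
  refine ⟨c 1, fun x hx => ?_⟩
  have key := isOpen_Ioi.is_const_of_deriv_eq_zero (𝕜 := ℝ) isPreconnected_Ioi
    (fun y hy => (hconst y hy).differentiableAt.differentiableWithinAt)
    (fun y hy => (hconst y hy).deriv) (Set.mem_Ioi.2 (Real.sqrt_pos.2 hx)) (Set.mem_Ioi.2 one_pos)
  have hx0 : ((√x : ℝ) : ℂ) ≠ 0 := by exact_mod_cast (Real.sqrt_pos.2 hx).ne'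
  have key1 : h ((√x : ℝ) : ℂ) / ((√x : ℝ) : ℂ) = c x := by
    rw [hcr _ (Real.sqrt_pos.2 hx), Real.sq_sqrt hx.le, mul_div_cancel_right₀ _ hx0]
  have key2 : h ((1 : ℝ) : ℂ) / ((1 : ℝ) : ℂ) = c 1 := by
    rw [hcr 1 one_pos]; simp
  exact_mod_cast key1.symm.trans (key.trans key2)

theorem sqNorm_axis {x : ℝ} (hx : 0 < x) : sqNorm (((√x : ℝ) : ℂ), 0) = x := by
  simp [sqNorm, Real.sq_sqrt hx.le]

theorem axis_ne {x : ℝ} (hx : 0 < x) : ((((√x : ℝ) : ℂ), 0) : CTwo).1 ≠ 0 := by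
  simpa using (Real.sqrt_pos.2 hx).ne'

/-- The Kähler condition on the axis `v = 0`. -/
theorem deriv_eq_of_isClosedAt {g : FormField} {A A1 B B1 : ℝ → ℝ} (hc : IsCalabi g A B)
    (hA : ∀ x, 0 < x → HasDerivAt A (A1 x) x) (hB : ∀ x, 0 < x → HasDerivAt B (B1 x) x)
    {x : ℝ} (hx : 0 < x) (hcl : IsClosedAt g (((√x : ℝ) : ℂ), 0)) : B1 x = A x := by
  set p : CTwo := (((√x : ℝ) : ℂ), 0) with hp
  have hp1 : p.1 ≠ 0 := axis_ne hx
  have hρ : sqNorm p = x := sqNorm_axis hx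
  have hgr : ∀ c a b, pd c (fun q => gram g q a b) p =
      pd c (fun q => calabiMatrix A B q a b) p := by
    intro c a b
    have : (fun q => gram g q a b) =ᶠ[𝓝 p] fun q => calabiMatrix A B q a b := by
      filter_upwards [eventually_fst_ne hp1] with q hq
      rw [hc q hq]
    rw [pd, this.fderiv_eq, pd]
  have h3 := hcl.2.2.1
  rw [hgr, hgr, hgr, (hasGrad_calabi_E hA hB hp1).2, (hasGrad_calabi_R (B := B) hA hp1).2,
    (hasGrad_calabi_I (B := B) hA hp1).2, hρ] at h3
  simp [hp] at h3
  have hr : √x ≠ 0 := (Real.sqrt_pos.2 hx).ne'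
  refine mul_left_cancel₀ (mul_ne_zero two_ne_zero hr) ?_
  linarith

/-- Along the axis `v = 0` the gradient of a function of `ρ` is radial. -/
theorem gradient_calabi {g : FormField} {A B : ℝ → ℝ} (hc : IsCalabi g A B) {S S1 : ℝ → ℝ}
    (hS : ∀ x, 0 < x → HasDerivAt S (S1 x) x) {f : CTwo → ℝ}
    (hf : ∀ p : CTwo, p.1 ≠ 0 → f p = S (sqNorm p)) {z : ℂ} (hz : z ≠ 0)
    (hA0 : A (z.re ^ 2 + z.im ^ 2) ≠ 0) (hB0 : B (z.re ^ 2 + z.im ^ 2) ≠ 0) :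
    (gradient g f (z, 0)).1 =
      ((2 * S1 (z.re ^ 2 + z.im ^ 2) / A (z.re ^ 2 + z.im ^ 2) : ℝ) : ℂ) * z := by
  set p : CTwo := (z, 0) with hp
  have hp1 : p.1 ≠ 0 := hz
  have hρ : sqNorm p = z.re ^ 2 + z.im ^ 2 := by simp [sqNorm, hp]
  have hgrad : HasGrad f _ p := ((hasGrad_sqNorm p).comp (hS _ (sqNorm_pos hp1))).congr_eventually
    (by filter_upwards [eventually_fst_ne hp1] with q hq using hf q hq)
  set x := z.re ^ 2 + z.im ^ 2 with hx
  have e2 : p.2.re = 0 := rfl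
  have e3 : p.2.im = 0 := rfl
  have hw : gramInv g p = Matrix.diagonal ![(A x)⁻¹, (A x)⁻¹, (B x)⁻¹, (B x)⁻¹] := by
    refine Matrix.inv_eq_left_inv ?_
    rw [hc p hp1]
    ext i j
    fin_cases i <;> fin_cases j <;>
      simp [calabiMatrix, Matrix.mul_apply, Fin.sum_univ_four, hρ, hA0, hB0, e2, e3]
  simp only [gradient, hw, hgrad.2, Fin.sum_univ_four, hρ]
  apply Complex.ext <;> simp [frame, hp] <;> field_simp

namespace Metric

variable {k g : Metric}

theorem radial_pos (g : Metric) (i : Fin 4) (x : ℝ) : 0 < radial (g.form (0, 0)) i x :=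
  g.gram_diag_pos _ _ i

theorem radialScal_pos (h : g.IsScalRescaling k) (x : ℝ) : 0 < k.radialScal x := h.scal_pos _ _

/-- The conformal factor `s` is the square root of a smooth function, so no regularity of the
curvature itself is needed. -/
theorem IsScalRescaling.continuous_scal (h : g.IsScalRescaling k) (c : ChartIx) :
    Continuous (scal (k.form c)) := by
  have : scal (k.form c) = fun p => √(scal (k.form c) p ^ 2) :=
    funext fun p => (Real.sqrt_sq (h.scal_pos c p).le).symm
  rw [this]
  exact (h.contDiff_sq c).continuous.sqrt

theorem contDiffOn_radialScal (h : g.IsScalRescaling k) :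
    ContDiffOn ℝ ∞ k.radialScal (Set.Ioi 0) := by
  have h1 : ContDiffOn ℝ ∞ (fun x => k.radialScal x ^ 2) (Set.Ioi 0) := fun x hx =>
    ((contDiff_axis (h.contDiff_sq (0, 0))).contDiffAt.comp x
      (Real.contDiffAt_sqrt (ne_of_gt hx))).contDiffWithinAt
  refine (h1.sqrt fun x _ => pow_ne_zero 2 (radialScal_pos h x).ne').congr fun x _ => ?_
  exact (Real.sqrt_sq (radialScal_pos h x).le).symm

/-- The Kähler condition: the coefficient `|ξ₂|²` of `k` on the axis is a momentum coordinate, whose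
derivative in `ρ` is the coefficient of `|ξ₁|²`. -/
theorem hasDerivAt_radial_two (h : g.IsScalRescaling k) (hk : k.IsKahler) (hg : g.IsU2Invariant)
    {x : ℝ} (hx : 0 < x) :
    HasDerivAt (radial (k.form (0, 0)) 2) (radial (k.form (0, 0)) 0 x) x := by
  have hA := fun x (hx : 0 < x) =>
    hasDerivAt_of_contDiffOn_Ioi (contDiffOn_radial (k.smooth (0, 0)) 0) hx
  have hB := fun x (hx : 0 < x) =>
    hasDerivAt_of_contDiffOn_Ioi (contDiffOn_radial (k.smooth (0, 0)) 2) hx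
  rw [← deriv_eq_of_isClosedAt (isCalabi_radial_kahler h hk hg 0) hA hB hx
    (isClosedAt_of_isKahler hk _ _)]
  exact hB x hx

/-- For an extremal metric the scalar curvature is an affine function of the momentum
coordinate. -/
theorem exists_hasDerivAt_radialScal (h : g.IsScalRescaling k) (hk : k.IsExtremal)
    (hg : g.IsU2Invariant) :
    ∃ α : ℝ, ∀ x, 0 < x → HasDerivAt k.radialScal (α * radial (k.form (0, 0)) 0 x) x := by
  have hS := fun x (hx : 0 < x) => hasDerivAt_of_contDiffOn_Ioi (contDiffOn_radialScal h) hx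
  have hd : Differentiable ℂ fun z : ℂ =>
      (gradient (k.form (0, 0)) (scal (k.form (0, 0))) (z, 0)).1 :=
    ((hk.2 (0, 0)).comp (differentiable_id.prodMk (differentiable_const _))).fst
  obtain ⟨α, hα⟩ := const_of_holomorphic_radial hd
    (c := fun x => 2 * deriv k.radialScal x / radial (k.form (0, 0)) 0 x) fun z hz =>
      gradient_calabi (isCalabi_radial_kahler h hk.1 hg 0) hS
        (fun p hp => scal_eq_radialScal h hk.1 hg 0 hp) hz (k.radial_pos _ _).ne'
        (k.radial_pos _ _).ne'
  refine ⟨α / 2, fun x hx => (hS x hx).congr_deriv ?_⟩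
  have := hα x hx
  rw [div_eq_iff (k.radial_pos 0 x).ne'] at this
  linarith

/-- The derivative of `x θ` with respect to the momentum coordinate `x`, where `θ = ρ dx/dρ`. -/
def momentumSlope (k : Metric) (x : ℝ) : ℝ :=
  x * radial (k.form (0, 0)) 0 x + radial (k.form (0, 0)) 2 x *
    (1 + x * deriv (radial (k.form (0, 0)) 0) x / radial (k.form (0, 0)) 0 x)

theorem hasDerivAt_mul_profile (h : g.IsScalRescaling k) (hk : k.IsKahler)
    (hg : g.IsU2Invariant) {x : ℝ} (hx : 0 < x) :
    HasDerivAt (fun x => radial (k.form (0, 0)) 2 x * (x * radial (k.form (0, 0)) 0 x))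
      (radial (k.form (0, 0)) 0 x * k.momentumSlope x) x := by
  have hA := hasDerivAt_of_contDiffOn_Ioi (contDiffOn_radial (k.smooth (0, 0)) 0) hx
  refine ((hasDerivAt_radial_two h hk hg hx).fun_mul
    ((hasDerivAt_id x).fun_mul hA)).congr_deriv ?_
  have := (k.radial_pos 0 x).ne'
  simp only [momentumSlope, id]
  field_simp

theorem scal_axis (k : Metric) {x : ℝ} :
    scal (k.form (0, 0)) (((√x : ℝ) : ℂ), 0) = k.radialScal x := rfl

/-- The equation `scal k = s` in terms of the momentum profile. -/
theorem hasDerivAt_momentumSlope (h : g.IsScalRescaling k) (hk : k.IsKahler)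
    (hg : g.IsU2Invariant) {x : ℝ} (hx : 0 < x) :
    HasDerivAt k.momentumSlope (radial (k.form (0, 0)) 0 x *
      (8 - radial (k.form (0, 0)) 2 x * k.radialScal x) / 4) x := by
  have sA := contDiffOn_radial (k.smooth (0, 0)) 0
  have hA := fun x (hx : 0 < x) => hasDerivAt_of_contDiffOn_Ioi sA hx
  have hA1 := fun x (hx : 0 < x) => hasDerivAt_of_contDiffOn_Ioi (contDiffOn_deriv_Ioi sA) hx
  have hB := fun x (hx : 0 < x) => hasDerivAt_radial_two h hk hg hx
  have ha0 := (k.radial_pos 0 x).ne'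
  have hb0 := (k.radial_pos 2 x).ne'
  have hs := scal_calabi (k.smooth (0, 0)) (k.det_gram_ne _) (isCalabi_radial_kahler h hk hg 0)
    hA hA1 hB hA (Real.sqrt_pos.2 hx) (Real.sq_sqrt hx.le).symm ha0 hb0
  have hd := ((hasDerivAt_id x).fun_mul (hA x hx)).fun_add ((hB x hx).fun_mul
    ((((hasDerivAt_id x).fun_mul (hA1 x hx)).fun_div (hA x hx) ha0).const_add 1))
  refine hd.congr_deriv ?_
  rw [scal_axis] at hs
  rw [hs]
  simp only [id]
  field_simp
  ring

/-- The equation `scal g = κ` for `g = s⁻² k` in terms of the momentum profile. -/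
theorem conformal_scal_eq (h : g.IsScalRescaling k) (hk : k.IsKahler) (hg : g.IsU2Invariant)
    {α κ : ℝ}
    (hS : ∀ x, 0 < x → HasDerivAt k.radialScal (α * radial (k.form (0, 0)) 0 x) x)
    (hκ : ∀ p, scal (g.form (0, 0)) p = κ) {x : ℝ} (hx : 0 < x) :
    radial (k.form (0, 0)) 2 x * (κ - k.radialScal x ^ 3) =
      24 * α * (k.radialScal x * k.momentumSlope x
        - 2 * α * (radial (k.form (0, 0)) 2 x * (x * radial (k.form (0, 0)) 0 x))) := by
  have sA := contDiffOn_radial (k.smooth (0, 0)) 0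
  have hA := fun x (hx : 0 < x) => hasDerivAt_of_contDiffOn_Ioi sA hx
  have hA1 := fun x (hx : 0 < x) => hasDerivAt_of_contDiffOn_Ioi (contDiffOn_deriv_Ioi sA) hx
  have hB := fun x (hx : 0 < x) => hasDerivAt_radial_two h hk hg hx
  have hs := scal_calabi (k.smooth (0, 0)) (k.det_gram_ne _) (isCalabi_radial_kahler h hk hg 0)
    hA hA1 hB hA (Real.sqrt_pos.2 hx) (Real.sq_sqrt hx.le).symm (k.radial_pos 0 x).ne'
    (k.radial_pos 2 x).ne'
  rw [scal_axis] at hs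
  set a := radial (k.form (0, 0)) 0 with ha
  set b := radial (k.form (0, 0)) 2 with hb
  set S := k.radialScal with hSd
  have hS0 : ∀ x, S x ≠ 0 := fun x => (radialScal_pos h x).ne'
  have ha0 : a x ≠ 0 := (k.radial_pos 0 x).ne'
  have hb0 : b x ≠ 0 := (k.radial_pos 2 x).ne'
  have eA : radial (g.form (0, 0)) 0 = fun x => a x / S x ^ 2 := funext fun x => by
    rw [ha, radial_eq h, mul_div_cancel_left₀ _ (pow_ne_zero 2 (hS0 x))]
  have eB : radial (g.form (0, 0)) 2 = fun x => b x / S x ^ 2 := funext fun x => by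
    rw [hb, radial_eq h, mul_div_cancel_left₀ _ (pow_ne_zero 2 (hS0 x))]
  have hc := isCalabi_radial h hk hg 0
  rw [eA, eB] at hc
  -- the first two derivatives of the coefficients `a / S²` and `b / S²` of `g`
  have gA : ∀ x, 0 < x → HasDerivAt (fun x => a x / S x ^ 2)
      (deriv a x / S x ^ 2 - 2 * α * a x ^ 2 / S x ^ 3) x := fun x hx => by
    refine ((hA x hx).fun_div ((hS x hx).fun_pow 2) (pow_ne_zero 2 (hS0 x))).congr_deriv ?_
    have := hS0 x
    simp
    field_simp
  have gA1 : ∀ x, 0 < x → HasDerivAt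
      (fun x => deriv a x / S x ^ 2 - 2 * α * a x ^ 2 / S x ^ 3)
      (deriv (deriv a) x / S x ^ 2 - 6 * α * a x * deriv a x / S x ^ 3
        + 6 * α ^ 2 * a x ^ 3 / S x ^ 4) x := fun x hx => by
    refine (((hA1 x hx).fun_div ((hS x hx).fun_pow 2) (pow_ne_zero 2 (hS0 x))).fun_sub
      ((((hA x hx).fun_pow 2).const_mul (2 * α)).fun_div ((hS x hx).fun_pow 3)
        (pow_ne_zero 3 (hS0 x)))).congr_deriv ?_
    have := hS0 x
    simp
    field_simp
    ring
  have gB : ∀ x, 0 < x → HasDerivAt (fun x => b x / S x ^ 2)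
      (a x / S x ^ 2 - 2 * α * a x * b x / S x ^ 3) x := fun x hx => by
    refine ((hB x hx).fun_div ((hS x hx).fun_pow 2) (pow_ne_zero 2 (hS0 x))).congr_deriv ?_
    have := hS0 x
    simp
    field_simp
  have gB1 : ∀ x, 0 < x → HasDerivAt (fun x => a x / S x ^ 2 - 2 * α * a x * b x / S x ^ 3)
      (deriv a x / S x ^ 2 - 4 * α * a x ^ 2 / S x ^ 3 - 2 * α * deriv a x * b x / S x ^ 3
        + 6 * α ^ 2 * a x ^ 2 * b x / S x ^ 4) x := fun x hx => by
    refine (((hA x hx).fun_div ((hS x hx).fun_pow 2) (pow_ne_zero 2 (hS0 x))).fun_sub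
      ((((hA x hx).const_mul (2 * α)).fun_mul (hB x hx)).fun_div ((hS x hx).fun_pow 3)
        (pow_ne_zero 3 (hS0 x)))).congr_deriv ?_
    have := hS0 x
    simp
    field_simp
    ring
  have hgs := scal_calabi (g.smooth (0, 0)) (g.det_gram_ne _) hc gA gA1 gB gB1
    (Real.sqrt_pos.2 hx) (Real.sq_sqrt hx.le).symm
    (div_ne_zero ha0 (pow_ne_zero 2 (hS0 x))) (div_ne_zero hb0 (pow_ne_zero 2 (hS0 x)))
  rw [hκ] at hgs
  have hSx := hS0 x
  rw [hgs]
  simp only [momentumSlope, ← ha, ← hb]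
  generalize deriv (deriv a) x = a2 at *
  generalize deriv a x = a1 at *
  generalize a x = a0 at *
  generalize b x = b0 at *
  generalize S x = s at *
  linear_combination (norm := (field_simp; ring)) (-b0 * s ^ 2) * hs

end Metric

/-! ### The algebra of the boundary conditions -/

/-- A quartic that just fails to vanish near `y = 1.095`. Its coefficients are the bounds in
`page_constants`. -/
theorem page_quartic_pos {y : ℝ} (h1 : 1 ≤ y) :
    0 < 5 * y ^ 4 - 5.12681 * y ^ 3 - 10.08767 * y ^ 2 + 14.27712 * y - 3.99462 := by
  -- `1.0949` is close to the minimum; the other factor is the quotient by `(y - 1.0949) ^ 2`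
  have h3 : 0 ≤ (y - 1.0949) ^ 2 * (5 * y ^ 2 + 5.82219 * y - 3.33209) :=
    mul_nonneg (sq_nonneg _) (by nlinarith)
  nlinarith

/-- The positive root of `t⁴ - 4 t - 3`; as `t (t³ - 4) = 3`, the polynomial changes sign only
once. -/
theorem page_ratio_bounds {t : ℝ} (h0 : 0 < t) (h : t ^ 4 - 4 * t - 3 = 0) :
    1.7843579 < t ∧ t < 1.7843580 := by
  constructor
  · by_contra! hle
    have h3 : t ^ 3 ≤ 1.7843579 ^ 3 := pow_le_pow_left₀ h0.le hle 3
    have h4 : t * (t ^ 3 - 4) = 3 := by linear_combination h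
    have h5 : 0 < t ^ 3 - 4 := by
      by_contra! hn
      nlinarith
    nlinarith
  · by_contra! hle
    have h3 : 1.7843580 ^ 3 ≤ t ^ 3 := pow_le_pow_left₀ (by norm_num) hle 3
    have h4 : t * (t ^ 3 - 4) = 3 := by linear_combination h
    nlinarith

/-- The normalised constants of the Page metric as functions of the ratio `t` of the extreme values
of the scalar curvature, in units in which the smaller value is `1`. The bounds are those that the
quartic of `page_laplacian_le` needs. -/
theorem page_constants {t α β κ : ℝ} (h0 : 0 < t) (h : t ^ 4 - 4 * t - 3 = 0)
    (hα : 24 * α * (1 + t) = t ^ 3 - 1) (hβ : β * (t ^ 3 + 3 * t + 2) = 3 * (1 + t))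
    (hκ : κ * (1 + t) = t ^ 3 + t) :
    8 * β < 5.12681 ∧ 144 * α < 10.08767 ∧ 14.27712 < 5.32475 * κ ∧ 2.32475 * β * κ < 3.99462 ∧
      0 < κ ∧ 0 < β ∧ 0 < α := by
  obtain ⟨l, u⟩ := page_ratio_bounds h0 h
  have l3 : 1.7843579 ^ 3 < t ^ 3 := pow_lt_pow_left₀ l (by norm_num) (by norm_num)
  have u3 : t ^ 3 < 1.7843580 ^ 3 := pow_lt_pow_left₀ u h0.le (by norm_num)
  have hα' : α = (t ^ 3 - 1) / (24 * (1 + t)) := by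
    rw [eq_div_iff (by positivity)]; linarith
  have hβ' : β = 3 * (1 + t) / (t ^ 3 + 3 * t + 2) := by
    rw [eq_div_iff (by positivity)]; linarith
  have hκ' : κ = (t ^ 3 + t) / (1 + t) := by
    rw [eq_div_iff (by positivity)]; linarith
  have b1 : β < 0.6408509 := by
    rw [hβ', div_lt_iff₀ (by positivity)]; norm_num at *; linarith
  have b2 : 0 < β := by rw [hβ']; positivity
  have k1 : 2.6812755 < κ := by
    rw [hκ', lt_div_iff₀ (by positivity)]; norm_num at *; linarith
  have k2 : κ < 2.681278 := by
    rw [hκ', div_lt_iff₀ (by positivity)]; norm_num at *; linarith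
  have a1 : α < 0.07005326 := by
    rw [hα', div_lt_iff₀ (by positivity)]; norm_num at *; linarith
  have a2 : 0 < α := by
    rw [hα']; refine div_pos ?_ (by positivity); norm_num at *; linarith
  refine ⟨by linarith, by linarith, by linarith, ?_, by linarith, b2, a2⟩
  nlinarith

/-- The closing conditions at the two boundary curves determine the ratio of the values of `s`
there. -/
theorem page_ratio_eq {α β κ x0 x1 s0 s1 : ℝ} (h0 : 0 < s0) (h1 : 0 < s1) (hne : s0 ≠ s1)
    (e0 : s0 = α * x0 + β) (e1 : s1 = α * x1 + β)
    (k0 : κ = s0 ^ 3 + 24 * α * s0) (k1 : κ = s1 ^ 3 - 24 * α * s1)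
    (b0 : 8 * β = x0 * s0 ^ 2) (b1 : x1 * s1 ^ 2 = 32 * s1 - 8 * β) :
    s1 ^ 4 - 4 * s1 * s0 ^ 3 - 3 * s0 ^ 4 = 0 := by
  have hα : 24 * α * (s0 + s1) = s1 ^ 3 - s0 ^ 3 := by linarith
  have hx0 : x0 * (2 * s0 ^ 3 + 3 * s0 ^ 2 * s1 + s1 ^ 3) = 24 * s0 * (s0 + s1) := by
    linear_combination (-24 * (s0 + s1)) * e0 - 3 * (s0 + s1) * b0 - x0 * hα
  have hx1 : x1 * (2 * s1 ^ 3 + 3 * s1 ^ 2 * s0 + s0 ^ 3) = 72 * s1 * (s0 + s1) := by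
    linear_combination (24 * (s0 + s1)) * e1 + 3 * (s0 + s1) * b1 + x1 * hα
  have hd : (s1 - s0) * (24 * (s0 + s1)) = (s1 ^ 3 - s0 ^ 3) * (x1 - x0) := by
    linear_combination (24 * (s0 + s1)) * (e1 - e0) + (x1 - x0) * hα
  have hd2 : (s1 - s0) * (24 * (s0 + s1)) * ((2 * s0 ^ 3 + 3 * s0 ^ 2 * s1 + s1 ^ 3)
      * (2 * s1 ^ 3 + 3 * s1 ^ 2 * s0 + s0 ^ 3)) = (s1 ^ 3 - s0 ^ 3) * (24 * (s0 + s1))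
      * (3 * s1 * (2 * s0 ^ 3 + 3 * s0 ^ 2 * s1 + s1 ^ 3)
        - s0 * (2 * s1 ^ 3 + 3 * s1 ^ 2 * s0 + s0 ^ 3)) := by
    linear_combination ((2 * s0 ^ 3 + 3 * s0 ^ 2 * s1 + s1 ^ 3)
      * (2 * s1 ^ 3 + 3 * s1 ^ 2 * s0 + s0 ^ 3)) * hd
      + (s1 ^ 3 - s0 ^ 3) * (2 * s0 ^ 3 + 3 * s0 ^ 2 * s1 + s1 ^ 3) * hx1
      - (s1 ^ 3 - s0 ^ 3) * (2 * s1 ^ 3 + 3 * s1 ^ 2 * s0 + s0 ^ 3) * hx0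
  have hs : s1 - s0 ≠ 0 := sub_ne_zero.2 hne.symm
  have hs' : s0 + s1 ≠ 0 := by positivity
  have : (24 * (s0 + s1) * (s1 - s0) ^ 3) * (s1 ^ 4 - 4 * s1 * s0 ^ 3 - 3 * s0 ^ 4) = 0 := by
    linear_combination -hd2
  exact (mul_eq_zero.1 this).resolve_left
    (mul_ne_zero (mul_ne_zero (by norm_num) hs') (pow_ne_zero 3 hs))

/-! ### The one-variable estimate -/

/-- The estimate at a point where the momentum coordinate is `b`, the scalar curvature `s` and the
profile `θ`, with `W = (x θ)'`. The hypotheses on `x0`, `x1` are the closing conditions; those on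
`b`, `s`, `W`, `θ` are the scalar curvature equation of `g` and its derivative. Eliminating `W` and
`θ` turns the claim into a quartic inequality in `s`; its coefficients `5.32475 = 4 + 2.6495 / 2`
and `2.32475 = 1 + 2.6495 / 2` come from the constant `2.6495`. -/
theorem page_laplacian_le {α β κ x0 x1 s0 s1 : ℝ} (h0 : 0 < s0) (h1 : 0 < s1) (hne : s0 ≠ s1)
    (e0 : s0 = α * x0 + β) (e1 : s1 = α * x1 + β)
    (k0 : κ = s0 ^ 3 + 24 * α * s0) (k1 : κ = s1 ^ 3 - 24 * α * s1)
    (b0 : 8 * β = x0 * s0 ^ 2) (b1 : x1 * s1 ^ 2 = 32 * s1 - 8 * β) :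
    0 < κ ∧ ∀ b s W θ : ℝ, 0 < b → x0 ≤ b → s = α * b + β →
      b * (κ - s ^ 3) = 24 * α * (s * W - 2 * α * (b * θ)) →
      24 * α ^ 2 * W = 48 * α * s - 3 * α * b * s ^ 2 - κ + s ^ 3 →
      8 * α * (α * θ + s * W / b) ≤ 2.6495 * κ / 12 := by
  have hr := page_ratio_eq h0 h1 hne e0 e1 k0 k1 b0 b1
  have hα : 24 * α * (s0 + s1) = s1 ^ 3 - s0 ^ 3 := by linarith
  have hx0 : x0 * (2 * s0 ^ 3 + 3 * s0 ^ 2 * s1 + s1 ^ 3) = 24 * s0 * (s0 + s1) := by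
    linear_combination (-24 * (s0 + s1)) * e0 - 3 * (s0 + s1) * b0 - x0 * hα
  have hs0 := h0.ne'
  -- normalise to `s0 = 1`
  obtain ⟨c1, c2, c3, c4, c5, c6, c7⟩ := page_constants (t := s1 / s0) (α := α / s0 ^ 2)
    (β := β / s0) (κ := κ / s0 ^ 3) (div_pos h1 h0) (by field_simp; linear_combination hr)
    (by field_simp; linear_combination hα)
    (by field_simp; linear_combination (2 * s0 ^ 3 + 3 * s0 ^ 2 * s1 + s1 ^ 3) / 8 * b0
          + s0 ^ 2 / 8 * hx0)
    (by field_simp; linear_combination s1 * k0 + s0 * k1)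
  have hκ : 0 < κ := by
    have := mul_pos c5 (pow_pos h0 3)
    rwa [div_mul_cancel₀ _ (pow_ne_zero 3 hs0)] at this
  have hα0 : 0 < α := by
    have := mul_pos c7 (pow_pos h0 2)
    rwa [div_mul_cancel₀ _ (pow_ne_zero 2 hs0)] at this
  refine ⟨hκ, fun b s W θ hb hxb hs h2 h3 => ?_⟩
  have hy : 1 ≤ s / s0 := by
    rw [one_le_div h0, hs, e0]
    nlinarith
  have hp := page_quartic_pos hy
  set y := s / s0 with hyd
  set α' := α / s0 ^ 2 with hα'
  set β' := β / s0 with hβ'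
  set κ' := κ / s0 ^ 3 with hκ'
  have r1 : s = s0 * y := by rw [hyd]; field_simp
  have r2 : α = s0 ^ 2 * α' := by rw [hα']; field_simp
  have r3 : β = s0 * β' := by rw [hβ']; field_simp
  have r4 : κ = s0 ^ 3 * κ' := by rw [hκ']; field_simp
  have hq : 0 ≤ 5 * y ^ 4 - 8 * β' * y ^ 3 - 144 * α' * y ^ 2 + 5.32475 * κ' * y
      - 2.32475 * β' * κ' := by
    have i1 : 8 * β' * y ^ 3 ≤ 5.12681 * y ^ 3 :=
      mul_le_mul_of_nonneg_right c1.le (by positivity)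
    have i2 : 144 * α' * y ^ 2 ≤ 10.08767 * y ^ 2 :=
      mul_le_mul_of_nonneg_right c2.le (by positivity)
    have i3 : 14.27712 * y ≤ 5.32475 * κ' * y :=
      mul_le_mul_of_nonneg_right c3.le (by positivity)
    linarith
  have hq2 : 0 ≤ 5 * s ^ 4 - 8 * β * s ^ 3 - 144 * α * s ^ 2 + 5.32475 * κ * s
      - 2.32475 * β * κ := by
    have := mul_nonneg (pow_nonneg h0.le 4) hq
    rw [r1, r2, r3, r4]
    linarith
  have hL : 8 * α * (α * θ + s * W / b) = 8 * α * (α * (b * θ) + s * W) / b := by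
    field_simp
  rw [hL, div_le_iff₀ hb]
  refine le_of_mul_le_mul_left ?_ (mul_pos (by norm_num : (0 : ℝ) < 6) hα0)
  have hab : α * b = s - β := by linarith
  have key : 6 * α * (8 * α * (α * (b * θ) + s * W)) =
      -5 * s ^ 4 + 8 * β * s ^ 3 + 144 * α * s ^ 2 - 4 * κ * s + β * κ := by
    linear_combination α * h2 + 3 * s * h3 - (κ + 8 * s ^ 3) * hab
  have : 6 * α * (2.6495 * κ / 12 * b) = 1.32475 * κ * (s - β) := by
    rw [← hab]; ring
  rw [key, this]
  linarith

/-- The one-variable form of the estimate. The variable is `ρ`; `b` is the momentum coordinate `x`,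
`θ = ρ b'` the momentum profile, `W` the derivative of `x θ` with respect to `x`. The limits at `0`
and `∞` are the closing conditions at the exceptional curve and at the line at infinity. -/
theorem radial_estimate {a b S W θ : ℝ → ℝ} {α κ x0 x1 s0 s1 : ℝ}
    (ha : ∀ x, 0 < x → 0 < a x) (hb : ∀ x, 0 < x → HasDerivAt b (a x) x)
    (hS : ∀ x, 0 < x → HasDerivAt S (α * a x) x)
    (hW : ∀ x, 0 < x → HasDerivAt W (a x * (8 - b x * S x) / 4) x)
    (hP : ∀ x, 0 < x → HasDerivAt (fun x => b x * θ x) (a x * W x) x)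
    (h2 : ∀ x, 0 < x → b x * (κ - S x ^ 3) = 24 * α * (S x * W x - 2 * α * (b x * θ x)))
    (hx0 : 0 < x0) (hs0 : 0 < s0) (hs1 : 0 < s1)
    (lb0 : Tendsto b (𝓝[>] 0) (𝓝 x0)) (lS0 : Tendsto S (𝓝[>] 0) (𝓝 s0))
    (lθ0 : Tendsto θ (𝓝[>] 0) (𝓝 0)) (lW0 : Tendsto W (𝓝[>] 0) (𝓝 x0))
    (lb1 : Tendsto b atTop (𝓝 x1)) (lS1 : Tendsto S atTop (𝓝 s1))
    (lθ1 : Tendsto θ atTop (𝓝 0)) (lW1 : Tendsto W atTop (𝓝 (-x1))) :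
    0 < κ ∧ ∀ x, 0 < x → 8 * α * (α * θ x + S x * W x / b x) ≤ 2.6495 * κ / 12 := by
  have hmem0 : ∀ᶠ x : ℝ in 𝓝[>] 0, 0 < x := self_mem_nhdsWithin
  have hmem1 : ∀ᶠ x : ℝ in atTop, 0 < x := eventually_gt_atTop 0
  -- functions with vanishing derivative on `(0, ∞)` are constant
  have hconst : ∀ f : ℝ → ℝ, (∀ x, 0 < x → HasDerivAt f 0 x) → ∃ C, ∀ x, 0 < x → f x = C :=
    fun f hf => ⟨f 1, fun x hx => isOpen_Ioi.is_const_of_deriv_eq_zero isPreconnected_Ioi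
      (fun y hy => (hf y hy).differentiableAt.differentiableWithinAt)
      (fun y hy => (hf y hy).deriv) hx (Set.mem_Ioi.2 one_pos)⟩
  have hlim : ∀ {f : ℝ → ℝ} {C l : ℝ} {F : Filter ℝ} [F.NeBot], (∀ᶠ x in F, 0 < x) →
      (∀ x, 0 < x → f x = C) → Tendsto f F (𝓝 l) → l = C := fun hF hf hl =>
    tendsto_nhds_unique (hl.congr' (hF.mono hf)) tendsto_const_nhds
  -- the momentum coordinate increases from `x0` to `x1`
  have hmono : StrictMonoOn b (Set.Ioi 0) := by
    refine strictMonoOn_of_deriv_pos (convex_Ioi 0)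
      (fun x hx => (hb x hx).continuousAt.continuousWithinAt) fun x hx => ?_
    rw [interior_Ioi] at hx
    rw [(hb x hx).deriv]
    exact ha x hx
  have hlow : ∀ x, 0 < x → x0 ≤ b x := fun x hx => le_of_tendsto lb0 <| by
    filter_upwards [Ioo_mem_nhdsGT hx] with y hy
    exact (hmono hy.1 hx hy.2).le
  have hupp : ∀ x, 0 < x → b x ≤ x1 := fun x hx => ge_of_tendsto lb1 <| by
    filter_upwards [eventually_gt_atTop x] with y hy
    exact (hmono hx (hx.trans hy) hy).le
  have hx01 : x0 < x1 := (hlow 1 one_pos).trans_lt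
    ((hmono (Set.mem_Ioi.2 one_pos) (Set.mem_Ioi.2 two_pos) one_lt_two).trans_le (hupp 2 two_pos))
  obtain ⟨β, hβ⟩ := hconst (fun x => S x - α * b x) fun x hx => by
    exact ((hS x hx).fun_sub ((hb x hx).const_mul α)).congr_deriv (by ring)
  have e0 : s0 = α * x0 + β := by linarith [hlim hmem0 hβ (lS0.sub (lb0.const_mul α))]
  have e1 : s1 = α * x1 + β := by linarith [hlim hmem1 hβ (lS1.sub (lb1.const_mul α))]
  -- the scalar curvature equation of `g` at the two boundary curves
  have h2' : ∀ x, 0 < x →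
      b x * (κ - S x ^ 3) - 24 * α * (S x * W x - 2 * α * (b x * θ x)) = 0 :=
    fun x hx => by rw [h2 x hx, sub_self]
  have k0 : x0 * (κ - s0 ^ 3) - 24 * α * (s0 * x0 - 2 * α * (x0 * 0)) = 0 :=
    hlim hmem0 h2' ((lb0.mul ((lS0.pow 3).const_sub κ)).sub
      (((lS0.mul lW0).sub ((lb0.mul lθ0).const_mul (2 * α))).const_mul (24 * α)))
  have k1 : x1 * (κ - s1 ^ 3) - 24 * α * (s1 * -x1 - 2 * α * (x1 * 0)) = 0 :=
    hlim hmem1 h2' ((lb1.mul ((lS1.pow 3).const_sub κ)).sub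
      (((lS1.mul lW1).sub ((lb1.mul lθ1).const_mul (2 * α))).const_mul (24 * α)))
  have k0' : κ = s0 ^ 3 + 24 * α * s0 := mul_left_cancel₀ hx0.ne' (by linarith)
  have k1' : κ = s1 ^ 3 - 24 * α * s1 := mul_left_cancel₀ (hx0.trans hx01).ne' (by linarith)
  by_cases hα : α = 0
  · -- no metric of constant scalar curvature closes up
    exfalso
    subst hα
    have hS0 : ∀ x, 0 < x → S x = β := fun x hx => by simpa using hβ x hx
    obtain ⟨C, hC⟩ := hconst (fun x => W x - 2 * b x + β / 8 * b x ^ 2) fun x hx => by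
      have := ((hW x hx).fun_sub ((hb x hx).const_mul 2)).fun_add
        (((hb x hx).fun_pow 2).const_mul (β / 8))
      refine this.congr_deriv ?_
      rw [hS0 x hx]; simp; ring
    obtain ⟨D, hD⟩ := hconst (fun x => b x * θ x - b x ^ 2 + β / 24 * b x ^ 3 - C * b x)
      fun x hx => by
        have := (((hP x hx).fun_sub ((hb x hx).fun_pow 2)).fun_add
          (((hb x hx).fun_pow 3).const_mul (β / 24))).fun_sub ((hb x hx).const_mul C)
        refine this.congr_deriv ?_
        rw [← hC x hx]; simp; ring
    -- `W` and `b θ` are polynomials in `b`, and the four boundary values are incompatible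
    have C0 := hlim hmem0 hC ((lW0.sub (lb0.const_mul 2)).add ((lb0.pow 2).const_mul (β / 8)))
    have C1 := hlim hmem1 hC ((lW1.sub (lb1.const_mul 2)).add ((lb1.pow 2).const_mul (β / 8)))
    have D0 := hlim hmem0 hD ((((lb0.mul lθ0).sub (lb0.pow 2)).add
      ((lb0.pow 3).const_mul (β / 24))).sub (lb0.const_mul C))
    have D1 := hlim hmem1 hD ((((lb1.mul lθ1).sub (lb1.pow 2)).add
      ((lb1.pow 3).const_mul (β / 24))).sub (lb1.const_mul C))
    have f1 : β * (x1 ^ 2 - x0 ^ 2) = 8 * (3 * x1 - x0) := by linarith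
    have f2 : β * (x1 ^ 3 - x0 ^ 3) = 24 * x1 ^ 2 := by
      rw [← C0] at D0
      rw [← C1] at D1
      linarith
    have f3 : 8 * x0 * (x1 - x0) ^ 3 = 0 := by
      linear_combination (x1 ^ 3 - x0 ^ 3) * f1 - (x1 ^ 2 - x0 ^ 2) * f2
    have : 0 < 8 * x0 * (x1 - x0) ^ 3 := by
      have := sub_pos.2 hx01
      positivity
    exact this.ne' f3
  · -- differentiate the scalar curvature equation of `g`
    have h3 : ∀ x, 0 < x →
        24 * α ^ 2 * W x - (48 * α * S x - 3 * α * b x * S x ^ 2 - κ + S x ^ 3) = 0 := by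
      intro x hx
      have d1 := (hb x hx).fun_mul (((hS x hx).fun_pow 3).const_sub κ)
      have d2 := (((hS x hx).fun_mul (hW x hx)).fun_sub
        ((hP x hx).const_mul (2 * α))).const_mul (24 * α)
      have d3 := d1.congr_of_eventuallyEq (f₁ := fun x =>
        24 * α * (S x * W x - 2 * α * (b x * θ x)))
        (by filter_upwards [Ioi_mem_nhds hx] with y hy using (h2 y hy).symm)
      have d4 := d2.unique d3
      refine mul_left_cancel₀ (ha x hx).ne' ?_
      simp at d4
      linear_combination -d4
    have B0 := hlim hmem0 h3 ((lW0.const_mul (24 * α ^ 2)).sub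
      ((((lS0.const_mul (48 * α)).sub ((lb0.const_mul (3 * α)).mul (lS0.pow 2))).sub_const κ).add
        (lS0.pow 3)))
    have B1 := hlim hmem1 h3 ((lW1.const_mul (24 * α ^ 2)).sub
      ((((lS1.const_mul (48 * α)).sub ((lb1.const_mul (3 * α)).mul (lS1.pow 2))).sub_const κ).add
        (lS1.pow 3)))
    have b0 : 8 * β = x0 * s0 ^ 2 := by
      refine mul_left_cancel₀ (mul_ne_zero three_ne_zero hα) ?_
      rw [k0'] at B0
      linear_combination -B0 - 24 * α * e0
    have b1 : x1 * s1 ^ 2 = 32 * s1 - 8 * β := by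
      refine mul_left_cancel₀ (mul_ne_zero three_ne_zero hα) ?_
      rw [k1'] at B1
      linear_combination B1 - 24 * α * e1
    have hne : s0 ≠ s1 := by
      rw [e0, e1]
      intro h
      exact hx01.ne (mul_left_cancel₀ hα (add_right_cancel h))
    obtain ⟨hκ, hbound⟩ := page_laplacian_le hs0 hs1 hne e0 e1 k0' k1' b0 b1
    refine ⟨hκ, fun x hx => hbound (b x) (S x) (W x) (θ x) (hx0.trans_le (hlow x hx)) (hlow x hx)
      (by linarith [hβ x hx]) (h2 x hx) (by linarith [h3 x hx])⟩

/-! ### Closing conditions at the two boundary curves -/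

theorem tendsto_sqrt_zero : Tendsto (fun x : ℝ => √x) (𝓝[>] 0) (𝓝 0) := by
  have := (Real.continuous_sqrt.tendsto 0).mono_left (nhdsWithin_le_nhds (s := Set.Ioi 0))
  simpa using this

theorem tendsto_inv_sqrt_atTop : Tendsto (fun x : ℝ => (√x)⁻¹) atTop (𝓝 0) :=
  Real.tendsto_sqrt_atTop.inv_tendsto_atTop

theorem tendsto_axis {f : CTwo → ℝ} (hf : Continuous f) {e : ℝ → ℝ} {F : Filter ℝ}
    (he : Tendsto e F (𝓝 0)) : Tendsto (fun x => f (((e x : ℝ) : ℂ), 0)) F (𝓝 (f (0, 0))) := by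
  have h : Continuous fun r : ℝ => f ((r : ℂ), 0) := by fun_prop
  have := (h.tendsto 0).comp he
  simp only [Complex.ofReal_zero] at this
  exact this

/-- The logarithmic derivative at `0` of a smooth positive function of `√x`. -/
theorem tendsto_logDeriv_comp_sqrt {a φ : ℝ → ℝ} (hφ : ContDiff ℝ ∞ φ) (h0 : φ 0 ≠ 0)
    (ha : ∀ x, 0 < x → a x = φ √x) :
    Tendsto (fun x => x * deriv a x / a x) (𝓝[>] 0) (𝓝 0) := by
  have hd : ∀ x, 0 < x → deriv a x = deriv φ √x * (1 / (2 * √x)) := by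
    intro x hx
    have h1 := ((hφ.differentiable (by simp)) √x).hasDerivAt.comp x (Real.hasDerivAt_sqrt hx.ne')
    refine (h1.congr_of_eventuallyEq ?_).deriv
    filter_upwards [Ioi_mem_nhds hx] with y hy using ha y hy
  have hc : Continuous (deriv φ) := hφ.continuous_deriv (by simp)
  have h1 : Tendsto (fun x : ℝ => √x / 2 * deriv φ √x / φ √x) (𝓝[>] 0)
      (𝓝 (0 / 2 * deriv φ 0 / φ 0)) :=
    ((tendsto_sqrt_zero.div_const 2).mul ((hc.tendsto 0).comp tendsto_sqrt_zero)).div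
      ((hφ.continuous.tendsto 0).comp tendsto_sqrt_zero) h0
  rw [zero_div, zero_mul, zero_div] at h1
  refine h1.congr' ?_
  filter_upwards [self_mem_nhdsWithin] with x (hx : 0 < x)
  have hs := (Real.sqrt_pos.2 hx).ne'
  have hxs : x = √x * √x := (Real.mul_self_sqrt hx.le).symm
  rw [hd x hx, ha x hx]
  conv_rhs => rw [hxs, Real.sqrt_mul_self (Real.sqrt_nonneg x)]
  field_simp

/-- The logarithmic derivative at infinity of `x⁻²` times a smooth positive function of
`1 / √x`. -/
theorem tendsto_logDeriv_comp_inv_sqrt {a ψ : ℝ → ℝ} (hψ : ContDiff ℝ ∞ ψ) (h0 : ∀ r, ψ r ≠ 0)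
    (ha : ∀ x, 0 < x → a x = ψ (√x)⁻¹ / x ^ 2) :
    Tendsto (fun x => x * deriv a x / a x) atTop (𝓝 (-2)) := by
  have hd : ∀ x, 0 < x → deriv a x =
      (deriv ψ (√x)⁻¹ * (-(1 / (2 * √x)) / √x ^ 2) * x ^ 2 - ψ (√x)⁻¹ * (2 * x)) / (x ^ 2) ^ 2 := by
    intro x hx
    have hs := (Real.sqrt_pos.2 hx).ne'
    have h1 := ((hψ.differentiable (by simp)) (√x)⁻¹).hasDerivAt.comp x
      ((Real.hasDerivAt_sqrt hx.ne').fun_inv hs)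
    have h2 := h1.fun_div ((hasDerivAt_id x).fun_pow 2) (pow_ne_zero 2 hx.ne')
    have h3 : deriv a x = _ := (h2.congr_of_eventuallyEq (f₁ := a)
      (by filter_upwards [Ioi_mem_nhds hx] with y hy using ha y hy)).deriv
    rw [h3]
    simp
  have hc : Continuous (deriv ψ) := hψ.continuous_deriv (by simp)
  have ht := tendsto_inv_sqrt_atTop
  have h1 : Tendsto (fun x : ℝ => -2 - (√x)⁻¹ / 2 * deriv ψ (√x)⁻¹ / ψ (√x)⁻¹) atTop
      (𝓝 (-2 - 0 / 2 * deriv ψ 0 / ψ 0)) :=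
    (((ht.div_const 2).mul ((hc.tendsto 0).comp ht)).div
      ((hψ.continuous.tendsto 0).comp ht) (h0 0)).const_sub (-2)
  rw [zero_div, zero_mul, zero_div, sub_zero] at h1
  refine h1.congr' ?_
  filter_upwards [eventually_gt_atTop 0] with x hx
  have hs := (Real.sqrt_pos.2 hx).ne'
  have hψ0 := h0 (√x)⁻¹
  have hs2 : √x ^ 2 = x := Real.sq_sqrt hx.le
  rw [hd x hx, ha x hx, hs2]
  generalize ψ (√x)⁻¹ = P at *
  generalize deriv ψ (√x)⁻¹ = Q at *
  field_simp
  ring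

namespace Metric

variable {k g : Metric}

theorem sqNormInf_axis {x : ℝ} (hx : 0 < x) : sqNormInf ((((√x)⁻¹ : ℝ) : ℂ), 0) = x := by
  simp [sqNormInf, Real.sq_sqrt hx.le]

theorem axis_inv_ne {x : ℝ} (hx : 0 < x) : (((((√x)⁻¹ : ℝ) : ℂ), 0) : CTwo).1 ≠ 0 := by
  simpa using (Real.sqrt_pos.2 hx).ne'

theorem gram_inf_axis (h : g.IsScalRescaling k) (hk : k.IsKahler) (hg : g.IsU2Invariant)
    {x : ℝ} (hx : 0 < x) :
    radial (k.form (0, 0)) 0 x = gram (k.form (1, 0)) ((((√x)⁻¹ : ℝ) : ℂ), 0) 0 0 / x ^ 2 ∧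
      radial (k.form (0, 0)) 2 x = gram (k.form (1, 0)) ((((√x)⁻¹ : ℝ) : ℂ), 0) 2 2 := by
  rw [gram_inf h hk hg 0 (axis_inv_ne hx), calabiMatrixInf, sqNormInf_axis hx]
  have hx0 := hx.ne'
  constructor
  · simp [hermMatrix, Real.sq_sqrt hx.le]
    field_simp
  · simp [hermMatrix]

/-- The one-variable estimate applied to the momentum profile of `k`. -/
theorem momentum_estimate (h : g.IsScalRescaling k) (hk : k.IsExtremal) (hg : g.IsU2Invariant)
    {κ : ℝ} (hκ : ∀ p, scal (g.form (0, 0)) p = κ) :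
    0 < κ ∧ ∃ α : ℝ,
      (∀ x, 0 < x → HasDerivAt k.radialScal (α * radial (k.form (0, 0)) 0 x) x) ∧
      ∀ x, 0 < x → 8 * α * (α * (x * radial (k.form (0, 0)) 0 x)
        + k.radialScal x * k.momentumSlope x / radial (k.form (0, 0)) 2 x) ≤ 2.6495 * κ / 12 := by
  obtain ⟨α, hα⟩ := exists_hasDerivAt_radialScal h hk hg
  have hinf := fun x (hx : 0 < x) => gram_inf_axis h hk.1 hg hx
  have hcs : ∀ c i, Continuous fun p => gram (k.form c) p i i := fun c i =>
    (contDiff_gram (k.smooth c) i i).continuous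
  have hsc := h.continuous_scal
  have hpos : ∀ᶠ x : ℝ in atTop, 0 < x := eventually_gt_atTop 0
  have lid : Tendsto (fun x : ℝ => x) (𝓝[>] 0) (𝓝 0) := nhdsWithin_le_nhds
  -- the limits at the exceptional curve
  have la0 : Tendsto (radial (k.form (0, 0)) 0) (𝓝[>] 0) _ :=
    tendsto_axis (hcs (0, 0) 0) tendsto_sqrt_zero
  have lb0 : Tendsto (radial (k.form (0, 0)) 2) (𝓝[>] 0) _ :=
    tendsto_axis (hcs (0, 0) 2) tendsto_sqrt_zero
  have lS0 : Tendsto k.radialScal (𝓝[>] 0) _ := tendsto_axis (hsc (0, 0)) tendsto_sqrt_zero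
  have lθ0 := lid.mul la0
  have lT0 := tendsto_logDeriv_comp_sqrt (a := radial (k.form (0, 0)) 0)
    (contDiff_axis (contDiff_gram (k.smooth (0, 0)) 0 0)) (k.gram_diag_pos _ _ 0).ne'
    fun x _ => rfl
  have lW0 : Tendsto k.momentumSlope (𝓝[>] 0) _ := lθ0.add (lb0.mul (lT0.const_add 1))
  -- the limits at the line at infinity
  have la1 : Tendsto (fun x => gram (k.form (1, 0)) ((((√x)⁻¹ : ℝ) : ℂ), 0) 0 0) atTop _ :=
    tendsto_axis (hcs (1, 0) 0) tendsto_inv_sqrt_atTop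
  have lb1 : Tendsto (radial (k.form (0, 0)) 2) atTop _ :=
    (tendsto_axis (hcs (1, 0) 2) tendsto_inv_sqrt_atTop).congr'
      (hpos.mono fun x hx => (hinf x hx).2.symm)
  have lS1 : Tendsto k.radialScal atTop _ :=
    (tendsto_axis (hsc (1, 0)) tendsto_inv_sqrt_atTop).congr' (hpos.mono fun x hx => by
      rw [scal_inf h hk.1 hg 0 (axis_inv_ne hx), sqNormInf_axis hx])
  have lθ1 : Tendsto (fun x => x * radial (k.form (0, 0)) 0 x) atTop _ :=
    (tendsto_inv_atTop_zero.mul la1).congr' (hpos.mono fun x hx => by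
      change _ = x * radial (k.form (0, 0)) 0 x
      rw [(hinf x hx).1]
      field_simp)
  have lT1 := tendsto_logDeriv_comp_inv_sqrt (a := radial (k.form (0, 0)) 0)
    (contDiff_axis (contDiff_gram (k.smooth (1, 0)) 0 0)) (fun r => (k.gram_diag_pos _ _ 0).ne')
    fun x hx => (hinf x hx).1
  have lW1 : Tendsto k.momentumSlope atTop _ := lθ1.add (lb1.mul (lT1.const_add 1))
  rw [zero_mul] at lθ0 lθ1
  rw [zero_mul, add_zero, mul_one, zero_add] at lW0
  rw [zero_mul, zero_add, show (1 + -2 : ℝ) = -1 by norm_num, mul_neg_one] at lW1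
  obtain ⟨hκ0, hb⟩ := radial_estimate (fun x _ => k.radial_pos 0 x)
    (fun x hx => hasDerivAt_radial_two h hk.1 hg hx) hα
    (fun x hx => hasDerivAt_momentumSlope h hk.1 hg hx)
    (fun x hx => hasDerivAt_mul_profile h hk.1 hg hx)
    (fun x hx => conformal_scal_eq h hk.1 hg hα hκ hx) (k.gram_diag_pos _ _ 2)
    (h.scal_pos _ _) (h.scal_pos _ _) lb0 lS0 lθ0 lW0 lb1 lS1 lθ1 lW1
  exact ⟨hκ0, α, hα, hb⟩

/-- The estimate for `Δ (s²)` at every point of the blow-up. -/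
theorem laplacianScalSq_le (h : g.IsScalRescaling k) (hk : k.IsExtremal) (hg : g.IsU2Invariant)
    {κ : ℝ} (hκ : ∀ p, scal (g.form (0, 0)) p = κ) :
    0 < κ ∧ ∀ x, k.laplacianScalSq x ≤ 2.6495 * κ / 12 := by
  obtain ⟨hκ0, α, hα, hb⟩ := momentum_estimate h hk hg hκ
  refine ⟨hκ0, ?_⟩
  have hA := fun x (hx : 0 < x) =>
    hasDerivAt_of_contDiffOn_Ioi (contDiffOn_radial (k.smooth (0, 0)) 0) hx
  have hF : ∀ x, 0 < x → HasDerivAt (fun x => k.radialScal x ^ 2)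
      (2 * α * (k.radialScal x * radial (k.form (0, 0)) 0 x)) x := fun x hx =>
    ((hα x hx).fun_pow 2).congr_deriv (by simp; ring)
  have hF1 : ∀ x, 0 < x →
      HasDerivAt (fun x => 2 * α * (k.radialScal x * radial (k.form (0, 0)) 0 x))
        (2 * α * (α * radial (k.form (0, 0)) 0 x * radial (k.form (0, 0)) 0 x
          + k.radialScal x * deriv (radial (k.form (0, 0)) 0) x)) x := fun x hx =>
    ((hα x hx).fun_mul (hA x hx)).const_mul (2 * α)
  have hL : ∀ x, 4 * (x * (2 * α * (α * radial (k.form (0, 0)) 0 x * radial (k.form (0, 0)) 0 x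
          + k.radialScal x * deriv (radial (k.form (0, 0)) 0) x)) / radial (k.form (0, 0)) 0 x
        + 2 * α * (k.radialScal x * radial (k.form (0, 0)) 0 x) / radial (k.form (0, 0)) 0 x
        + x * (2 * α * (k.radialScal x * radial (k.form (0, 0)) 0 x))
          / radial (k.form (0, 0)) 2 x) =
      8 * α * (α * (x * radial (k.form (0, 0)) 0 x)
        + k.radialScal x * k.momentumSlope x / radial (k.form (0, 0)) 2 x) := fun x => by
    have h1 := (k.radial_pos 0 x).ne'
    have h2 := (k.radial_pos 2 x).ne'
    rw [momentumSlope]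
    field_simp
    ring
  have hne : ∀ (c : ChartIx) (p : CTwo), p.1 ≠ 0 → k.laplacianScalSq (c, p) ≤ 2.6495 * κ / 12 := by
    rintro ⟨m, l⟩ p hp
    simp only [laplacianScalSq]
    fin_cases m
    · refine le_of_eq_of_le (laplacian_calabi (isHermitianForm_of_isKahler hk.1 _)
        (k.det_gram_ne _) (isCalabi_radial_kahler h hk.1 hg l) hp
        (isClosedAt_of_isKahler hk.1 _ p) hF hF1
        (fun q hq => congrArg (· ^ 2) (scal_eq_radialScal h hk.1 hg l hq))
        (k.radial_pos _ _).ne' (k.radial_pos _ _).ne') ?_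
      rw [hL]
      exact hb _ (sqNorm_pos hp)
    · refine le_of_eq_of_le (laplacian_calabiInf (isHermitianForm_of_isKahler hk.1 _)
        (k.det_gram_ne _) hp (gram_inf h hk.1 hg l hp)
        (isClosedAt_of_isKahler hk.1 _ p) hF hF1
        (fun q hq => congrArg (· ^ 2) (scal_inf h hk.1 hg l hq))
        (k.radial_pos _ _).ne' (k.radial_pos _ _).ne') ?_
      rw [hL]
      exact hb _ (sqNormInf_pos hp)
  -- the boundary curves `u = 0` are in the closure
  rintro ⟨c, p⟩
  by_cases hp : p.1 = 0
  · have hcont : Continuous fun z : ℂ => k.laplacianScalSq (c, (z, p.2)) :=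
      (continuous_laplacian (k.smooth c) (k.det_gram_ne c) (h.contDiff_sq c)).comp (by fun_prop)
    have hlim := (hcont.tendsto 0).mono_left (nhdsWithin_le_nhds (s := {0}ᶜ))
    have hp' : p = (0, p.2) := Prod.ext hp rfl
    rw [hp']
    refine le_of_tendsto hlim ?_
    filter_upwards [self_mem_nhdsWithin] with z hz using hne c (z, p.2) hz
  · exact hne c p hp

theorem IsEinstein.scal_eq {Λ : ℝ} (hE : g.IsEinstein Λ) (c : ChartIx) (p : CTwo) :
    scal (g.form c) p = 4 * Λ := by
  have h1 : ∀ a, ∑ b, gramInv (g.form c) p a b * gram (g.form c) p a b = 1 := fun a => by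
    have := congrFun (congrFun (gramInv_mul_gram (g.det_gram_ne c p)) a) a
    rw [Matrix.mul_apply, Matrix.one_apply_eq] at this
    rw [← this]
    exact Finset.sum_congr rfl fun b _ => congrArg _ (g.symm c p _ _)
  simp only [scal, hE c p, mul_left_comm, ← Finset.mul_sum, h1]
  simp
  ring

end Metric

end PageBlowup

end

theorem mainTheorem9 :
    (∀ k g : PageBlowup.Metric, k.IsExtremal → g.IsScalRescaling k → g.IsPage 3 →
      ∀ x, k.laplacianScalSq x < 15 / 4) ∧
    (∀ (k g : PageBlowup.Metric) (Λ κ : ℝ), k.IsExtremal → g.IsScalRescaling k → g.IsPage Λ →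
      (∀ x, g.scalarCurvature x = κ) →
      0 < κ ∧ BddAbove (Set.range k.laplacianScalSq) ∧
        12 * sSup (Set.range k.laplacianScalSq) / κ < 2.65) := by
  constructor
  · intro k g hk h hg x
    have := (PageBlowup.Metric.laplacianScalSq_le h hk hg.1 (hg.2.scal_eq (0, 0))).2 x
    linarith
  · intro k g Λ κ hk h hg hκ
    obtain ⟨hκ0, hb⟩ := PageBlowup.Metric.laplacianScalSq_le h hk hg.1 fun p => hκ ((0, 0), p)
    refine ⟨hκ0, ⟨_, Set.forall_mem_range.2 hb⟩, ?_⟩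
    have hs : sSup (Set.range k.laplacianScalSq) ≤ 2.6495 * κ / 12 :=
      csSup_le (Set.range_nonempty _) (Set.forall_mem_range.2 hb)
    rw [div_lt_iff₀ hκ0]
    linarith
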